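/- Let $n\ge 2$, $\alpha\ge 0$, $\sigma>0$, and write $x=(x',x_n)$ for points of $\mathbb R^n$, with $x'=(x_1,\dots,x_{n-1})$. Subscripts of functions denote partial derivatives. For all real $M_1,M_2$ there is a constant $C=C(n,\alpha,\sigma,M_1,M_2)$ with the following property. Let $\Omega\subset\mathbb R^n$ be a bounded open convex set and let $u\in C^4(\Omega)\cap C(\overline\Omega)$ be a convex function which is strictly increasing in the $e_n$ direction in $\Omega$, with $$u=\sigma x_n\quad\text{on }\partial\Omega,\qquad u_n^{\alpha}\,\det D^2u=f(x_2,\dots,x_{n-1},u)\quad\text{in }\Omega,$$ where $f$ is a function with $f(x_2,\dots,x_{n-1},u(x))>0$ for $x\in\Omega$ (if $n=2$, $f$ depends on $u$ only). Let $v(x',s)$ be the graph function, in the $-e_n$ direction, of the level set $\{u=s\}$ in $\Omega$, that is, $v(x',u(x))=-x_n$ for $x=(x',x_n)\in\Omega$, equivalently $u(x',-v(x',s))=s$. Assume that $u_n(x)\le M_1$ and $|v_1(x',u(x))|\le M_2$ for all $x\in\Omega$. Then $v$ is of class $C^4$ near $(x',u(x))$ for every $x\in\Omega$, and $$v_{11}(x',u(x))\,|u(x)-\sigma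 x_n|\le C\qquad\text{for all }x\in\Omega.$$ In particular $C$ does not depend on $f$ or $\Omega$. -/

import Mathlib

namespace LevelSetEstimate

noncomputable section

/-- The partial derivative `∂g/∂xᵢ` at `x`. -/
def partialDeriv {n : ℕ} (i : Fin n) (g : EuclideanSpace ℝ (Fin n) → ℝ)
    (x : EuclideanSpace ℝ (Fin n)) : ℝ :=
  lineDeriv ℝ g x (EuclideanSpace.single i 1)

/-- The Hessian matrix `D²g(x)`. -/
def hessian {n : ℕ} (g : EuclideanSpace ℝ (Fin n) → ℝ) (x : EuclideanSpace ℝ (Fin n)) :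
    Matrix (Fin n) (Fin n) ℝ :=
  Matrix.of fun i j => partialDeriv i (partialDeriv j g) x

/-- For `x = (x', xₙ)`, the point `(x', s)`. -/
def setLast {k : ℕ} (x : EuclideanSpace ℝ (Fin (k + 1))) (s : ℝ) :
    EuclideanSpace ℝ (Fin (k + 1)) :=
  WithLp.toLp 2 (Function.update x.ofLp (Fin.last k) s)

/-- `g` is strictly increasing in the direction of the last coordinate vector on `Ω`. -/
def IncreasingInLast {k : ℕ} (Ω : Set (EuclideanSpace ℝ (Fin (k + 1))))
    (g : EuclideanSpace ℝ (Fin (k + 1)) → ℝ) : Prop :=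
  ∀ x ∈ Ω, ∀ t, x (Fin.last k) < t → setLast x t ∈ Ω → g x < g (setLast x t)

/-- The middle coordinates `(x₂, …, xₙ₋₁)` of `x ∈ ℝⁿ`, `n = m + 2`. -/
def middle {m : ℕ} (x : EuclideanSpace ℝ (Fin (m + 2))) : Fin m → ℝ :=
  fun i => x i.succ.castSucc

/-- The graph function `v(x', s)` in the direction `-eₙ` of the level set `{u = s}` in `Ω`, so that
`u (x', -v(x', s)) = s`. The argument `y` stands for `(x', s)`. If `u` is strictly increasing in the
last variable, the set below is a singleton for `y` of the form `(x', u(x))`, `x ∈ Ω`,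
and empty for all other `y`. -/
def levelGraph {k : ℕ} (Ω : Set (EuclideanSpace ℝ (Fin (k + 1))))
    (u : EuclideanSpace ℝ (Fin (k + 1)) → ℝ) (y : EuclideanSpace ℝ (Fin (k + 1))) : ℝ :=
  -sInf {t : ℝ | setLast y t ∈ Ω ∧ u (setLast y t) = y (Fin.last k)}

end

end LevelSetEstimate

open Filter Topology Matrix

namespace LevelSetEstimate

/-- Necessary first and second order conditions at a local maximum in one variable. -/
theorem isLocalMax_second_order {φ φ' : ℝ → ℝ} {c x₀ : ℝ} (h : IsLocalMax φ x₀)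
    (h1 : ∀ᶠ t in 𝓝 x₀, HasDerivAt φ (φ' t) t) (h2 : HasDerivAt φ' c x₀) :
    φ' x₀ = 0 ∧ c ≤ 0 := by
  have h0 : φ' x₀ = 0 := h.hasDerivAt_eq_zero h1.self_of_nhds
  refine ⟨h0, ?_⟩
  by_contra! hc
  have hd : deriv φ =ᶠ[𝓝 x₀] φ' := h1.mono fun t ht => ht.deriv
  have hdd : deriv (deriv φ) x₀ = c := by rw [hd.deriv_eq, h2.deriv]
  have hmin : IsLocalMin φ x₀ := isLocalMin_of_deriv_deriv_pos (by rw [hdd]; exact hc)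
    (by rw [hd.self_of_nhds, h0]) h1.self_of_nhds.continuousAt
  have hconst : φ =ᶠ[𝓝 x₀] fun _ => φ x₀ := by
    filter_upwards [h, hmin] with t h₁ h₂ using le_antisymm h₁ h₂
  have : deriv φ =ᶠ[𝓝 x₀] fun _ => 0 := by
    simpa using hconst.deriv
  have : deriv (deriv φ) x₀ = 0 := by rw [this.deriv_eq]; simp
  linarith

section Det

variable {ι : Type*} [Fintype ι] [DecidableEq ι]

/-- Jacobi's formula for the derivative of a determinant. -/
theorem hasDerivAt_det {M : ℝ → Matrix ι ι ℝ} {M' : Matrix ι ι ℝ} {t : ℝ}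
    (h : ∀ i j, HasDerivAt (fun s => M s i j) (M' i j) t) :
    HasDerivAt (fun s => (M s).det) ((M t).adjugate * M').trace t := by
  have key : ((M t).adjugate * M').trace =
      ∑ σ : Equiv.Perm ι, ((Equiv.Perm.sign σ : ℤ) : ℝ) *
        ∑ i, (∏ j ∈ Finset.univ.erase i, M t (σ j) j) • M' (σ i) i := by
    have h1 : ∀ i, ((M t).adjugate * M') i i = ((M t).updateCol i (fun j => M' j i)).det := by
      intro i
      rw [← cramer_apply, cramer_eq_adjugate_mulVec]
      rfl
    simp_rw [trace, diag_apply, h1, det_apply', Finset.mul_sum]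
    rw [Finset.sum_comm]
    refine Finset.sum_congr rfl fun σ _ => Finset.sum_congr rfl fun i _ => ?_
    rw [← Finset.prod_erase_mul _ _ (Finset.mem_univ i), updateCol_self, smul_eq_mul]
    congr 2
    refine Finset.prod_congr rfl fun j hj => ?_
    rw [updateCol_ne (Finset.ne_of_mem_erase hj)]
  simp_rw [key, det_apply']
  refine HasDerivAt.fun_sum fun σ _ => ?_
  refine HasDerivAt.const_mul _ ?_
  exact HasDerivAt.fun_finsetProd fun i _ => h (σ i) i

theorem differentiableAt_det {M : ℝ → Matrix ι ι ℝ} {t : ℝ}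
    (h : ∀ i j, DifferentiableAt ℝ (fun s => M s i j) t) :
    DifferentiableAt ℝ (fun s => (M s).det) t :=
  (hasDerivAt_det (M' := of fun i j => deriv (fun s => M s i j) t)
    fun i j => (h i j).hasDerivAt).differentiableAt

/-- The derivative of the adjugate at the identity matrix. -/
theorem hasDerivAt_adjugate_of_eq_one {M : ℝ → Matrix ι ι ℝ} {M' : Matrix ι ι ℝ} {t : ℝ}
    (h1 : M t = 1) (h : ∀ i j, HasDerivAt (fun s => M s i j) (M' i j) t) (i j : ι) :
    HasDerivAt (fun s => (M s).adjugate i j) ((M'.trace • (1 : Matrix ι ι ℝ) - M') i j) t := by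
  have hd : ∀ i j, DifferentiableAt ℝ (fun s => (M s).adjugate i j) t := by
    intro i j
    simp_rw [adjugate_apply]
    refine differentiableAt_det fun k l => ?_
    by_cases hk : k = j
    · subst hk; simp
    · simpa [updateRow_ne hk] using (h k l).differentiableAt
  have e1 : HasDerivAt (fun s => ((M s).adjugate * M s) i j)
      (∑ k, (deriv (fun s => (M s).adjugate i k) t * M t k j + (M t).adjugate i k * M' k j)) t := by
    simp_rw [mul_apply]
    exact HasDerivAt.fun_sum fun k _ => (hd i k).hasDerivAt.mul (h k j)
  have e2 : HasDerivAt (fun s => ((M s).adjugate * M s) i j)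
      (M'.trace * (1 : Matrix ι ι ℝ) i j) t := by
    have := (hasDerivAt_det h).mul_const ((1 : Matrix ι ι ℝ) i j)
    simp_rw [adjugate_mul]
    simpa [h1] using this
  have e3 := e1.unique e2
  simp only [h1, adjugate_one, Finset.sum_add_distrib] at e3
  have e4 : ∑ k, deriv (fun s => (M s).adjugate i k) t * (1 : Matrix ι ι ℝ) k j
      = deriv (fun s => (M s).adjugate i j) t := by simp [one_apply]
  have e5 : ∑ k, (1 : Matrix ι ι ℝ) i k * M' k j = M' i j := by simp [one_apply]
  rw [e4, e5] at e3
  have := (hd i j).hasDerivAt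
  rw [eq_sub_of_add_eq e3] at this
  simpa using this

/-- If a twice differentiable matrix path through the identity has determinant `c * p ^ β`, then
the traces of its first two derivatives are determined by `p`. -/
theorem trace_of_det_eq_rpow {M M' : ℝ → Matrix ι ι ℝ} {M'' : Matrix ι ι ℝ}
    {p p' : ℝ → ℝ} {p'' β c : ℝ} (h1 : M 0 = 1)
    (hM : ∀ᶠ t in 𝓝 (0 : ℝ), ∀ i j, HasDerivAt (fun s => M s i j) (M' t i j) t)
    (hM' : ∀ i j, HasDerivAt (fun s => M' s i j) (M'' i j) 0)
    (hp : ∀ᶠ t in 𝓝 (0 : ℝ), HasDerivAt p (p' t) t) (hp' : HasDerivAt p' p'' 0)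
    (hp0 : 0 < p 0) (hdet : ∀ᶠ t in 𝓝 (0 : ℝ), (M t).det = c * p t ^ β) :
    (M' 0).trace = β * (p' 0 / p 0) ∧
    M''.trace = (∑ i, ∑ j, M' 0 i j * M' 0 j i) + β * (p'' / p 0 - (p' 0 / p 0) ^ 2) := by
  have hc : c * p 0 ^ β = 1 := by rw [← hdet.self_of_nhds, h1, det_one]
  have hpos : ∀ᶠ t in 𝓝 (0 : ℝ), 0 < p t :=
    hp.self_of_nhds.continuousAt.eventually (lt_mem_nhds hp0)
  have e : (fun t => ((M t).adjugate * M' t).trace) =ᶠ[𝓝 0]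
      fun t => c * (p' t * β * p t ^ (β - 1)) := by
    filter_upwards [hM, hp, hpos, hdet.eventually_nhds] with t h₁ h₂ h₃ h₄
    have d1 := hasDerivAt_det (h₁)
    have d2 := (h₂.rpow_const (p := β) (Or.inl h₃.ne')).const_mul c
    exact d1.unique (d2.congr_of_eventuallyEq h₄)
  have hne : p 0 ≠ 0 := hp0.ne'
  have r1 : c * p 0 ^ (β - 1) = 1 / p 0 := by
    rw [Real.rpow_sub_one hne, ← mul_div_assoc, hc]
  have r2 : c * p 0 ^ (β - 1 - 1) = 1 / p 0 ^ 2 := by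
    rw [Real.rpow_sub_one hne, ← mul_div_assoc, r1]; field_simp
  have t1 : (M' 0).trace = β * (p' 0 / p 0) := by
    have := e.self_of_nhds
    simp only [h1, adjugate_one, one_mul] at this
    rw [this]
    linear_combination (p' 0 * β) * r1
  refine ⟨t1, ?_⟩
  have d1 : HasDerivAt (fun t => ((M t).adjugate * M' t).trace)
      (∑ i, ∑ j, (((M' 0).trace • (1 : Matrix ι ι ℝ) - M' 0) i j * M' 0 j i
        + (M 0).adjugate i j * M'' j i)) 0 := by
    simp_rw [trace, diag_apply, mul_apply]
    refine HasDerivAt.fun_sum fun i _ => HasDerivAt.fun_sum fun j _ => ?_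
    exact (hasDerivAt_adjugate_of_eq_one h1 hM.self_of_nhds i j).mul (hM' j i)
  have d2 : HasDerivAt (fun t => c * (p' t * β * p t ^ (β - 1)))
      (c * (p'' * β * p 0 ^ (β - 1) + p' 0 * β * (p' 0 * (β - 1) * p 0 ^ (β - 1 - 1)))) 0 :=
    ((hp'.mul_const β).mul
      (hp.self_of_nhds.rpow_const (p := β - 1) (Or.inl hne))).const_mul c
  have e2 := d1.unique (d2.congr_of_eventuallyEq e)
  have e3 : (∑ i, ∑ j, (((M' 0).trace • (1 : Matrix ι ι ℝ) - M' 0) i j * M' 0 j i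
        + (M 0).adjugate i j * M'' j i)) =
      (M' 0).trace ^ 2 - (∑ i, ∑ j, M' 0 i j * M' 0 j i) + M''.trace := by
    simp only [h1, adjugate_one, Matrix.sub_apply, Matrix.smul_apply, smul_eq_mul, sub_mul,
      Finset.sum_add_distrib, Finset.sum_sub_distrib, one_apply, mul_ite, ite_mul, mul_one, one_mul,
      mul_zero, zero_mul, Finset.sum_ite_eq, Finset.mem_univ, if_true, ← Finset.mul_sum]
    rw [sq]; rfl
  have e4 : c * (p'' * β * p 0 ^ (β - 1) + p' 0 * β * (p' 0 * (β - 1) * p 0 ^ (β - 1 - 1)))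
      = p'' * β * (1 / p 0) + p' 0 * β * p' 0 * (β - 1) * (1 / p 0 ^ 2) := by
    rw [← r1, ← r2]; ring
  rw [e3, e4, t1] at e2
  have : M''.trace = (∑ i, ∑ j, M' 0 i j * M' 0 j i) + (p'' * β * (1 / p 0)
    + p' 0 * β * p' 0 * (β - 1) * (1 / p 0 ^ 2)) - (β * (p' 0 / p 0)) ^ 2 := by linarith
  rw [this]; field_simp; ring

end Det

open scoped MatrixOrder Matrix.Norms.L2Operator in
/-- A positive definite matrix is diagonalized to the identity by a congruence whose first column
is a multiple of the first coordinate vector. -/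
theorem exists_congruence_one {ι : Type*} [Fintype ι] [DecidableEq ι] {A : Matrix ι ι ℝ}
    (hA : A.PosDef) (i₀ : ι) :
    ∃ B : Matrix ι ι ℝ, Bᵀ * A * B = 1 ∧ ∀ i, B i i₀ = (√(A i₀ i₀))⁻¹ * (1 : Matrix ι ι ℝ) i i₀ := by
  obtain ⟨y, hy, hyA⟩ := CStarAlgebra.isStrictlyPositive_iff_eq_star_mul_self.mp
    hA.isStrictlyPositive
  rw [star_eq_conjTranspose, conjTranspose_eq_transpose_of_trivial] at hyA
  have hpos : 0 < A i₀ i₀ := hA.diag_pos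
  set r := √(A i₀ i₀) with hr
  have hr0 : 0 < r := Real.sqrt_pos.2 hpos
  have hrr : r * r = A i₀ i₀ := Real.mul_self_sqrt hpos.le
  let w : EuclideanSpace ℝ ι := WithLp.toLp 2 fun i => r⁻¹ * y i i₀
  have hw : Orthonormal ℝ (({i₀} : Set ι).domRestrict fun _ => w) := by
    have hn : ‖w‖ = 1 := by
      rw [EuclideanSpace.norm_eq]
      have : ∑ i, ‖w i‖ ^ 2 = 1 := by
        have : ∑ i, ‖w i‖ ^ 2 = r⁻¹ ^ 2 * A i₀ i₀ := by
          simp only [Real.norm_eq_abs, sq_abs]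
          simp only [w, hyA, mul_apply, transpose_apply, Finset.mul_sum]
          exact Finset.sum_congr rfl fun i _ => by ring
        rw [this, ← hrr]; field_simp
      rw [this, Real.sqrt_one]
    refine ⟨fun _ => hn, fun i j hij => ?_⟩
    exact absurd (Subsingleton.elim i j) hij
  obtain ⟨b, hb⟩ := hw.exists_orthonormalBasis_extension_of_card_eq (by simp)
  let O : Matrix ι ι ℝ := of fun i k => b k i
  have hO : Oᵀ * O = 1 := by
    ext k l
    have := b.inner_eq_ite l k
    simp only [PiLp.inner_apply, RCLike.inner_apply, conj_trivial] at this
    simp only [mul_apply, transpose_apply, O, of_apply, one_apply, eq_comm (a := k)]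
    exact this
  have hdet : IsUnit y.det := (isUnit_iff_isUnit_det y).1 hy
  refine ⟨y⁻¹ * O, ?_, fun i => ?_⟩
  · rw [hyA, transpose_mul, transpose_nonsing_inv]
    have hdet' : IsUnit yᵀ.det := by rwa [det_transpose]
    calc Oᵀ * yᵀ⁻¹ * (yᵀ * y) * (y⁻¹ * O) = Oᵀ * (yᵀ⁻¹ * yᵀ) * (y * y⁻¹) * O := by
          simp only [Matrix.mul_assoc]
      _ = 1 := by rw [nonsing_inv_mul _ hdet', mul_nonsing_inv _ hdet]; simp [hO]
  · have h1 : ∀ k, O k i₀ = r⁻¹ * y k i₀ := fun k => by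
      simp [O, hb i₀ rfl, w]
    rw [mul_apply]
    simp_rw [h1]
    rw [← nonsing_inv_mul y hdet, mul_apply, Finset.mul_sum]
    exact Finset.sum_congr rfl fun k _ => by ring

section DirectionalDerivatives

variable {E : Type*} [NormedAddCommGroup E] [NormedSpace ℝ E]

/-- The directional derivative of `g` in the direction `a`, as a function. -/
noncomputable def dirDeriv (a : E) (g : E → ℝ) (x : E) : ℝ := lineDeriv ℝ g x a

variable {V : Set E} {g h : E → ℝ} {x a b : E}

theorem dirDeriv_eq_fderiv (hg : DifferentiableAt ℝ g x) : dirDeriv a g x = fderiv ℝ g x a :=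
  hg.lineDeriv_eq_fderiv

theorem differentiableAt_of_contDiffOn {k : WithTop ℕ∞} (hV : IsOpen V) (hg : ContDiffOn ℝ k g V)
    (hk : k ≠ 0) (hx : x ∈ V) : DifferentiableAt ℝ g x :=
  (hg.contDiffAt (hV.mem_nhds hx)).differentiableAt hk

theorem contDiffOn_dirDeriv {k l : WithTop ℕ∞} (hV : IsOpen V) (hg : ContDiffOn ℝ k g V)
    (hkl : l + 1 ≤ k) (a : E) : ContDiffOn ℝ l (dirDeriv a g) V := by
  have hk : k ≠ 0 := by
    rintro rfl
    simp at hkl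
  refine ((hg.fderiv_of_isOpen hV hkl).clm_apply contDiffOn_const (g := fun _ => a)).congr ?_
  intro x hx
  exact dirDeriv_eq_fderiv (differentiableAt_of_contDiffOn hV hg hk hx)

theorem dirDeriv_congr (hV : IsOpen V) (hgh : Set.EqOn g h V) (hx : x ∈ V) :
    dirDeriv a g x = dirDeriv a h x :=
  (hgh.eventuallyEq_of_mem (hV.mem_nhds hx)).lineDeriv_eq

theorem dirDeriv_comm (hV : IsOpen V) (hg : ContDiffOn ℝ 2 g V) (hx : x ∈ V) (a b : E) :
    dirDeriv a (dirDeriv b g) x = dirDeriv b (dirDeriv a g) x := by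
  have key : ∀ a b : E, dirDeriv a (dirDeriv b g) x = fderiv ℝ (fderiv ℝ g) x a b := by
    intro a b
    rw [dirDeriv_congr hV (h := fun y => fderiv ℝ g y b)
      (fun y hy => dirDeriv_eq_fderiv (differentiableAt_of_contDiffOn hV hg two_ne_zero hy)) hx]
    have hd : DifferentiableAt ℝ (fderiv ℝ g) x :=
      ((hg.fderiv_of_isOpen hV (m := 1) (by norm_num)).contDiffAt
        (hV.mem_nhds hx)).differentiableAt one_ne_zero
    rw [dirDeriv_eq_fderiv (hd.clm_apply (differentiableAt_const b)),
      fderiv_clm_apply hd (differentiableAt_const b)]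
    simp
  rw [key, key]
  exact ((hg.contDiffAt (hV.mem_nhds hx)).isSymmSndFDerivAt (by simp)) a b

theorem dirDeriv_sum {ι : Type*} (s : Finset ι) (c : ι → ℝ) (e : ι → E)
    (hg : DifferentiableAt ℝ g x) :
    dirDeriv (∑ i ∈ s, c i • e i) g x = ∑ i ∈ s, c i * dirDeriv (e i) g x := by
  simp [dirDeriv_eq_fderiv hg]

theorem dirDeriv_smul (c : ℝ) (a : E) (g : E → ℝ) (x : E) :
    dirDeriv (c • a) g x = c * dirDeriv a g x := by
  simp [dirDeriv, lineDeriv_smul]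

theorem dirDeriv_const_mul (c : ℝ) (hg : DifferentiableAt ℝ g x) :
    dirDeriv a (fun y => c * g y) x = c * dirDeriv a g x := by
  rw [dirDeriv_eq_fderiv (hg.const_mul c), dirDeriv_eq_fderiv hg, fderiv_const_mul hg]
  simp

/-- The derivative of `g` along a line. -/
theorem hasDerivAt_line {t : ℝ} (hg : DifferentiableAt ℝ g (x + t • a)) :
    HasDerivAt (fun s => g (x + s • a)) (dirDeriv a g (x + t • a)) t := by
  rw [dirDeriv_eq_fderiv hg]
  have h1 : HasDerivAt (fun s : ℝ => x + s • a) a t := by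
    simpa using ((hasDerivAt_id t).smul_const a).const_add x
  exact hg.hasFDerivAt.comp_hasDerivAt t h1

theorem eventually_line_mem (hV : IsOpen V) (hx : x ∈ V) (a : E) :
    ∀ᶠ t in 𝓝 (0 : ℝ), x + t • a ∈ V := by
  have : ContinuousAt (fun t : ℝ => x + t • a) 0 := by fun_prop
  exact this.eventually (hV.mem_nhds (by simpa using hx))

/-- Second order necessary conditions at a local maximum, along a line. -/
theorem dirDeriv_of_isLocalMax (hV : IsOpen V) (hg : ContDiffOn ℝ 2 g V) (hx : x ∈ V)
    (hmax : IsLocalMax g x) (a : E) : dirDeriv a g x = 0 ∧ dirDeriv a (dirDeriv a g) x ≤ 0 := by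
  have h1 : IsLocalMax (fun t : ℝ => g (x + t • a)) 0 := by
    have : Tendsto (fun t : ℝ => x + t • a) (𝓝 0) (𝓝 x) := by
      have : ContinuousAt (fun t : ℝ => x + t • a) 0 := by fun_prop
      simpa [ContinuousAt] using this
    have := this.eventually hmax
    simpa [IsLocalMax, IsMaxFilter] using this
  have h2 := isLocalMax_second_order (φ' := fun t => dirDeriv a g (x + t • a))
    (c := dirDeriv a (dirDeriv a g) x) h1 ?_ ?_
  · simpa using h2
  · filter_upwards [eventually_line_mem hV hx a] with t ht
    exact hasDerivAt_line (differentiableAt_of_contDiffOn hV hg two_ne_zero ht)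
  · have := hasDerivAt_line (x := x) (a := a) (t := 0) (g := dirDeriv a g) (by
      simpa using differentiableAt_of_contDiffOn hV
        (contDiffOn_dirDeriv hV hg (l := 1) (by norm_num) a) one_ne_zero hx)
    simpa using this

/-- A convex `C²` function has nonnegative second derivatives. -/
theorem dirDeriv_dirDeriv_nonneg (hV : IsOpen V) (hg : ContDiffOn ℝ 2 g V)
    (hc : ConvexOn ℝ V g) (hx : x ∈ V) (a : E) : 0 ≤ dirDeriv a (dirDeriv a g) x := by
  let L : ℝ →ᵃ[ℝ] E := AffineMap.lineMap x (x + a)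
  have hL : ∀ t, L t = x + t • a := fun t => by simp [L, AffineMap.lineMap_apply, add_comm]
  have hS : IsOpen (L ⁻¹' V) := by
    refine hV.preimage ?_
    have : (L : ℝ → E) = fun t => x + t • a := funext hL
    rw [this]; fun_prop
  have h0 : (0 : ℝ) ∈ L ⁻¹' V := by simpa [hL] using hx
  have hder : ∀ t ∈ L ⁻¹' V, HasDerivAt (g ∘ L) (dirDeriv a g (x + t • a)) t := by
    intro t ht
    have hgL : g ∘ L = fun s => g (x + s • a) := funext fun s => by simp [hL]
    rw [hgL]
    exact hasDerivAt_line (differentiableAt_of_contDiffOn hV hg two_ne_zero (by simpa [hL] using ht))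
  have hmono : MonotoneOn (deriv (g ∘ L)) (L ⁻¹' V) :=
    (hc.comp_affineMap L).monotoneOn_deriv fun t ht => (hder t ht).differentiableAt
  have h1 : HasDerivAt (fun t : ℝ => dirDeriv a g (x + t • a)) (dirDeriv a (dirDeriv a g) x) 0 := by
    have := hasDerivAt_line (x := x) (a := a) (t := 0) (g := dirDeriv a g) (by
      simpa using differentiableAt_of_contDiffOn hV
        (contDiffOn_dirDeriv hV hg (l := 1) (by norm_num) a) one_ne_zero hx)
    simpa using this
  have h2 : deriv (g ∘ L) =ᶠ[𝓝 0] fun t => dirDeriv a g (x + t • a) := by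
    filter_upwards [hS.mem_nhds h0] with t ht using (hder t ht).deriv
  have h3 := h1.congr_of_eventuallyEq h2
  rw [← h3.deriv, ← derivWithin_of_isOpen hS h0]
  exact hmono.derivWithin_nonneg

end DirectionalDerivatives

/-- The algebraic core of the maximum principle argument. `T` is the matrix of third derivatives
`∂₁ D²v` in a basis orthonormal for `D²v` whose first vector is `e₁ / μ`; `ω i` is the logarithmic
derivative of the cutoff in direction `i`. -/
theorem trace_inequality {n : ℕ} {T : Matrix (Fin (n + 2)) (Fin (n + 2)) ℝ} (hT : T.IsSymm)
    {ω : Fin (n + 2) → ℝ} {μ α β A B : ℝ} (hμ : 0 < μ) (hα : 0 ≤ α) (hβ : β = n + 4 + α)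
    (htr : T.trace = β * A) (h0 : T 0 0 = -B) (hω : ∀ i : Fin (n + 1), ω i.succ = -T 0 i.succ / μ) :
    -(ω 0) ^ 2 - B ^ 2 / (3 * μ ^ 2) ≤ -(∑ i, ω i ^ 2) +
      ((∑ i, ∑ j, T i j * T j i) - (∑ i, T 0 i ^ 2) - β * A ^ 2) / μ ^ 2 := by
  have hTs : ∀ i j, T j i = T i j := fun i j => hT.apply i j
  have e1 : ∑ i, ω i ^ 2 = ω 0 ^ 2 + (∑ i : Fin (n + 1), T 0 i.succ ^ 2) / μ ^ 2 := by
    rw [Fin.sum_univ_succ]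
    simp_rw [hω, div_pow, neg_sq, Finset.sum_div]
  have e2 : (∑ i, ∑ j, T i j * T j i) - (∑ i, T 0 i ^ 2) =
      (∑ i : Fin (n + 1), T 0 i.succ ^ 2) +
        ∑ i : Fin (n + 1), ∑ j : Fin (n + 1), T i.succ j.succ ^ 2 := by
    have h1 : ∀ i j, T i j * T j i = T i j ^ 2 := fun i j => by rw [hTs i j, sq]
    simp_rw [h1]
    rw [Fin.sum_univ_succ (f := fun i => ∑ j, T i j ^ 2), add_sub_cancel_left,
      ← Finset.sum_add_distrib]
    refine Finset.sum_congr rfl fun i _ => ?_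
    rw [Fin.sum_univ_succ, hTs 0 i.succ]
  have e3 : ∑ i : Fin (n + 1), T i.succ i.succ ^ 2 ≤
      ∑ i : Fin (n + 1), ∑ j : Fin (n + 1), T i.succ j.succ ^ 2 :=
    Finset.sum_le_sum fun i _ => Finset.single_le_sum (f := fun j : Fin (n + 1) =>
      T i.succ j.succ ^ 2) (fun j _ => sq_nonneg _) (Finset.mem_univ i)
  have e4 : (β * A + B) ^ 2 ≤ (n + 1) * ∑ i : Fin (n + 1), T i.succ i.succ ^ 2 := by
    have h1 : ∑ i : Fin (n + 1), T i.succ i.succ = β * A + B := by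
      have : T.trace = T 0 0 + ∑ i : Fin (n + 1), T i.succ i.succ := Fin.sum_univ_succ _
      linarith
    have := sq_sum_le_card_mul_sum_sq (s := Finset.univ) (f := fun i : Fin (n + 1) => T i.succ i.succ)
    rw [h1] at this
    simpa using this
  have hn : (0 : ℝ) ≤ n := n.cast_nonneg
  have e5 : -(B ^ 2 / 3) ≤ (∑ i : Fin (n + 1), T i.succ i.succ ^ 2) - β * A ^ 2 := by
    have h1 : 0 ≤ (n + 1) * (B ^ 2 / 3 - β * A ^ 2) + (β * A + B) ^ 2 := by
      have : (n + 1) * (B ^ 2 / 3 - β * A ^ 2) + (β * A + B) ^ 2 =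
        (β * (3 + α) * A ^ 2 + 2 * β * A * B + (1 + (n + 1) / 3) * B ^ 2) := by rw [hβ]; ring
      rw [this]
      refine nonneg_of_mul_nonneg_right (a := 3 + α) ?_ (by linarith)
      have : (3 + α) * (β * (3 + α) * A ^ 2 + 2 * β * A * B + (1 + (n + 1) / 3) * B ^ 2) =
        β * ((3 + α) * A + B) ^ 2 + α * (n + 1) / 3 * B ^ 2 := by rw [hβ]; ring
      have hβ0 : 0 ≤ β := by linarith
      rw [this]; positivity
    have h2 : 0 ≤ (n + 1) * (B ^ 2 / 3 + (∑ i : Fin (n + 1), T i.succ i.succ ^ 2) - β * A ^ 2) := by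
      linarith
    have := nonneg_of_mul_nonneg_right h2 (by linarith)
    linarith
  have hμ2 : 0 < μ ^ 2 := by positivity
  rw [e1, e2]
  have : -(B ^ 2 / (3 * μ ^ 2)) ≤ ((∑ i : Fin (n + 1), ∑ j : Fin (n + 1), T i.succ j.succ ^ 2)
      - β * A ^ 2) / μ ^ 2 := by
    rw [← div_div, ← neg_div]
    gcongr
    linarith
  have e6 : ∀ p q r : ℝ, (p + q - r) / μ ^ 2 = p / μ ^ 2 + (q - r) / μ ^ 2 := fun p q r => by ring
  rw [e6]
  linarith

section Max

variable {E : Type*} [NormedAddCommGroup E] [NormedSpace ℝ E]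
variable {V : Set E} {f g h : E → ℝ} {x : E}

theorem dirDeriv_dirDeriv_dirDeriv_comm (hV : IsOpen V) (hg : ContDiffOn ℝ 3 g V) (hx : x ∈ V)
    (a b : E) : dirDeriv a (dirDeriv b (dirDeriv b g)) x = dirDeriv b (dirDeriv b (dirDeriv a g)) x := by
  rw [dirDeriv_comm hV (contDiffOn_dirDeriv hV hg (by norm_num) b) hx]
  exact dirDeriv_congr hV (fun y hy => dirDeriv_comm hV (hg.of_le (by norm_num)) hy a b) hx

/-- First and second order conditions at a local maximum of `f * g * exp (γ h² / 2)`. -/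
theorem isLocalMax_mul_mul_exp (hV : IsOpen V) (hx : x ∈ V) (hf : ContDiffOn ℝ 2 f V)
    (hg : ContDiffOn ℝ 2 g V) (hh : ContDiffOn ℝ 2 h V) (hf0 : 0 < f x) (hg0 : 0 < g x) {γ : ℝ}
    (hmax : IsLocalMax (fun y => f y * g y * Real.exp (γ / 2 * h y ^ 2)) x) (a : E) :
    dirDeriv a f x / f x + dirDeriv a g x / g x + γ * h x * dirDeriv a h x = 0 ∧
    dirDeriv a (dirDeriv a f) x / f x - (dirDeriv a f x / f x) ^ 2
      + (dirDeriv a (dirDeriv a g) x / g x - (dirDeriv a g x / g x) ^ 2)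
      + γ * (dirDeriv a h x ^ 2 + h x * dirDeriv a (dirDeriv a h) x) ≤ 0 := by
  have hline : Tendsto (fun t : ℝ => x + t • a) (𝓝 0) (𝓝 x) := by
    have : ContinuousAt (fun t : ℝ => x + t • a) 0 := by fun_prop
    simpa [ContinuousAt] using this
  have hfx : ∀ᶠ t in 𝓝 (0 : ℝ), 0 < f (x + t • a) := hline.eventually
    ((hf.continuousOn.continuousAt (hV.mem_nhds hx)).eventually (lt_mem_nhds hf0))
  have hgx : ∀ᶠ t in 𝓝 (0 : ℝ), 0 < g (x + t • a) := hline.eventually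
    ((hg.continuousOn.continuousAt (hV.mem_nhds hx)).eventually (lt_mem_nhds hg0))
  have d1 : ∀ {k : E → ℝ}, ContDiffOn ℝ 2 k V → ∀ {t : ℝ}, x + t • a ∈ V →
      HasDerivAt (fun s => k (x + s • a)) (dirDeriv a k (x + t • a)) t := fun hk t ht =>
    hasDerivAt_line (differentiableAt_of_contDiffOn hV hk two_ne_zero ht)
  have d2 : ∀ {k : E → ℝ}, ContDiffOn ℝ 2 k V →
      HasDerivAt (fun s : ℝ => dirDeriv a k (x + s • a)) (dirDeriv a (dirDeriv a k) x) 0 :=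
    fun {k} hk => by
    have := hasDerivAt_line (x := x) (a := a) (t := 0) (g := dirDeriv a k) (by
      simpa using differentiableAt_of_contDiffOn hV
        (contDiffOn_dirDeriv hV hk (l := 1) (by norm_num) a) one_ne_zero hx)
    simpa using this
  have d0 : ∀ {k : E → ℝ}, ContDiffOn ℝ 2 k V →
      HasDerivAt (fun s : ℝ => k (x + s • a)) (dirDeriv a k x) 0 := fun {k} hk => by
    simpa using d1 hk (t := 0) (by simpa using hx)
  have hloc : IsLocalMax (fun t : ℝ => Real.log (f (x + t • a)) + Real.log (g (x + t • a))
      + γ / 2 * h (x + t • a) ^ 2) 0 := by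
    filter_upwards [hline.eventually hmax, hfx, hgx] with t h1 h2 h3
    have e1 : ∀ {p q r : ℝ}, 0 < p → 0 < q →
        Real.log (p * q * Real.exp r) = Real.log p + Real.log q + r := fun hp hq => by
      rw [Real.log_mul (mul_pos hp hq).ne' (Real.exp_ne_zero _), Real.log_mul hp.ne' hq.ne',
        Real.log_exp]
    simp only [zero_smul, add_zero]
    rw [← e1 h2 h3, ← e1 hf0 hg0]
    exact Real.log_le_log (by positivity) h1
  have key := isLocalMax_second_order (φ' := fun t : ℝ =>
    dirDeriv a f (x + t • a) / f (x + t • a) + dirDeriv a g (x + t • a) / g (x + t • a)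
      + γ * h (x + t • a) * dirDeriv a h (x + t • a))
    (c := dirDeriv a (dirDeriv a f) x / f x - (dirDeriv a f x / f x) ^ 2
      + (dirDeriv a (dirDeriv a g) x / g x - (dirDeriv a g x / g x) ^ 2)
      + γ * (dirDeriv a h x ^ 2 + h x * dirDeriv a (dirDeriv a h) x)) hloc ?_ ?_
  · simpa using key
  · filter_upwards [hfx, hgx, eventually_line_mem hV hx a] with t h1 h2 h3
    refine ((((d1 hf h3).log h1.ne').add ((d1 hg h3).log h2.ne')).add
      (((d1 hh h3).pow 2).const_mul (γ / 2))).congr_deriv ?_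
    push_cast
    ring
  · have q : ∀ {k : E → ℝ}, ContDiffOn ℝ 2 k V → 0 < k x →
        HasDerivAt (fun t : ℝ => dirDeriv a k (x + t • a) / k (x + t • a))
          (dirDeriv a (dirDeriv a k) x / k x - (dirDeriv a k x / k x) ^ 2) 0 := by
      intro k hk hk0
      refine ((d2 hk).fun_div (d0 hk) (by simpa using hk0.ne')).congr_deriv ?_
      simp only [zero_smul, add_zero]
      field_simp
    refine (((q hf hf0).add (q hg hg0)).add (((d0 hh).const_mul γ).mul (d2 hh))).congr_deriv ?_
    simp only [zero_smul, add_zero]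
    ring

end Max

variable {m : ℕ}

theorem partialDeriv_eq_dirDeriv {n : ℕ} (i : Fin n) (g : EuclideanSpace ℝ (Fin n) → ℝ) :
    partialDeriv i g = dirDeriv (EuclideanSpace.single i 1) g := rfl

theorem hessian_apply {n : ℕ} (g : EuclideanSpace ℝ (Fin n) → ℝ) (x : EuclideanSpace ℝ (Fin n))
    (i j : Fin n) : hessian g x i j = dirDeriv (EuclideanSpace.single i 1)
      (dirDeriv (EuclideanSpace.single j 1) g) x := rfl

/-- The second derivatives in the directions given by the columns of `B`. -/
theorem dirDeriv_dirDeriv_columns {n : ℕ} {V : Set (EuclideanSpace ℝ (Fin n))} (hV : IsOpen V)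
    {g : EuclideanSpace ℝ (Fin n) → ℝ} (hg : ContDiffOn ℝ 2 g V) {x : EuclideanSpace ℝ (Fin n)}
    (hx : x ∈ V) {ι : Type*} (B : Matrix (Fin n) ι ℝ) (k l : ι) :
    dirDeriv (WithLp.toLp 2 fun i => B i k) (dirDeriv (WithLp.toLp 2 fun i => B i l) g) x =
      (Bᵀ * hessian g x * B) k l := by
  have hb : ∀ k, (WithLp.toLp 2 fun i => B i k : EuclideanSpace ℝ (Fin n)) =
      ∑ i, B i k • EuclideanSpace.single i (1 : ℝ) := by
    intro k
    ext j
    simp [Pi.single_apply]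
  have hg' : ∀ a, ContDiffOn ℝ 1 (dirDeriv a g) V := fun a =>
    contDiffOn_dirDeriv hV hg (by norm_num) a
  rw [dirDeriv_comm hV hg hx, hb k, hb l, dirDeriv_congr hV (h := fun y => ∑ i, B i k *
    dirDeriv (EuclideanSpace.single i 1) g y) (fun y hy => dirDeriv_sum _ _ _
      (differentiableAt_of_contDiffOn hV hg two_ne_zero hy)) hx]
  have hd : ∀ i, DifferentiableAt ℝ (fun y => B i k * dirDeriv (EuclideanSpace.single i 1) g y) x :=
    fun i => (differentiableAt_of_contDiffOn hV (hg' _) one_ne_zero hx).const_mul _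
  rw [dirDeriv_sum _ _ _ (DifferentiableAt.fun_sum fun i _ => hd i)]
  rw [mul_apply]
  refine Finset.sum_congr rfl fun j _ => ?_
  rw [mul_comm]
  congr 1
  rw [dirDeriv_eq_fderiv (DifferentiableAt.fun_sum fun i _ => hd i), fderiv_fun_sum fun i _ => hd i,
    mul_apply, _root_.sum_apply]
  refine Finset.sum_congr rfl fun i _ => ?_
  rw [← dirDeriv_eq_fderiv (hd i), dirDeriv_const_mul _
    (differentiableAt_of_contDiffOn hV (hg' _) one_ne_zero hx), dirDeriv_comm hV hg hx]
  rfl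

/-- The inequality satisfied at an interior maximum of the auxiliary function
`(w - ε) v₁₁ exp (γ v₁² / 2)`, where `w = -(yₙ + σ v)` and `det D²v = c (-vₙ) ^ β` with `c`
independent of `y₁`. -/
theorem inequality_at_isLocalMax {V : Set (EuclideanSpace ℝ (Fin (m + 2)))} (hV : IsOpen V)
    {v : EuclideanSpace ℝ (Fin (m + 2)) → ℝ} (hv : ContDiffOn ℝ 4 v V)
    {y₀ : EuclideanSpace ℝ (Fin (m + 2))} (hy : y₀ ∈ V) {α β σ γ ε c : ℝ} (hα : 0 ≤ α)
    (hβ : β = m + 4 + α) (hpd : (hessian v y₀).PosDef)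
    (hn : partialDeriv (Fin.last (m + 1)) v y₀ < 0)
    (hdet : ∀ᶠ t in 𝓝 (0 : ℝ), (hessian v (y₀ + t • EuclideanSpace.single 0 1)).det =
      c * (-partialDeriv (Fin.last (m + 1)) v (y₀ + t • EuclideanSpace.single 0 1)) ^ β)
    {w p q l : ℝ} (hweq : -(y₀ (Fin.last (m + 1)) + σ * v y₀) - ε = w) (hw : 0 < w)
    (hp : partialDeriv 0 v y₀ = p) (hq : partialDeriv (Fin.last (m + 1)) v y₀ = q)
    (hl : partialDeriv 0 (partialDeriv 0 v) y₀ = l)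
    (hmax : IsLocalMax (fun y => (-(y (Fin.last (m + 1)) + σ * v y) - ε) *
      partialDeriv 0 (partialDeriv 0 v) y * Real.exp (γ / 2 * partialDeriv 0 v y ^ 2)) y₀) :
    (σ * (β - (m + 2)) + β / q) / w + γ * l - (σ * p) ^ 2 / (w ^ 2 * l)
      - (-(σ * p / w) + γ * p * l) ^ 2 / (3 * l) ≤ 0 := by
  obtain ⟨B, hB, hB0⟩ := exists_congruence_one hpd 0
  have hl' : hessian v y₀ 0 0 = l := hl
  have hlpos : 0 < l := hl' ▸ hpd.diag_pos
  rw [hl'] at hB0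
  set μ := √l with hμdef
  have hμ : 0 < μ := Real.sqrt_pos.2 hlpos
  have hμl : μ ^ 2 = l := Real.sq_sqrt hlpos.le
  simp only [partialDeriv_eq_dirDeriv] at hn hdet hp hq hl hmax
  set e₁ : EuclideanSpace ℝ (Fin (m + 2)) := EuclideanSpace.single 0 1 with he₁
  set eₙ : EuclideanSpace ℝ (Fin (m + 2)) := EuclideanSpace.single (Fin.last (m + 1)) 1 with heₙ
  let b : Fin (m + 2) → EuclideanSpace ℝ (Fin (m + 2)) := fun k => WithLp.toLp 2 fun i => B i k
  have hb0 : b 0 = μ⁻¹ • e₁ := by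
    ext i
    simp [b, hB0, he₁, one_apply]
  -- regularity
  have hv3 : ∀ a, ContDiffOn ℝ 3 (dirDeriv a v) V := fun a =>
    contDiffOn_dirDeriv hV hv (by norm_num) a
  have hv2 : ∀ a a', ContDiffOn ℝ 2 (dirDeriv a (dirDeriv a' v)) V := fun a a' =>
    contDiffOn_dirDeriv hV (hv3 a') (by norm_num) a
  have hv1 : ∀ a a' a'', ContDiffOn ℝ 1 (dirDeriv a (dirDeriv a' (dirDeriv a'' v))) V :=
    fun a a' a'' => contDiffOn_dirDeriv hV (hv2 a' a'') (by norm_num) a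
  have hv2' : ContDiffOn ℝ 2 v V := hv.of_le (by norm_num)
  -- derivatives along the line through `y₀` in direction `e₁`
  have hline : ∀ᶠ t in 𝓝 (0 : ℝ), y₀ + t • e₁ ∈ V := eventually_line_mem hV hy e₁
  have hder0 : ∀ {g : EuclideanSpace ℝ (Fin (m + 2)) → ℝ}, ContDiffOn ℝ 1 g V →
      HasDerivAt (fun s : ℝ => g (y₀ + s • e₁)) (dirDeriv e₁ g y₀) 0 := fun {g} hg => by
    have := hasDerivAt_line (x := y₀) (a := e₁) (t := 0) (g := g) (by
      simpa using differentiableAt_of_contDiffOn hV hg one_ne_zero hy)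
    simpa using this
  let M : ℝ → Matrix (Fin (m + 2)) (Fin (m + 2)) ℝ := fun t => of fun k j =>
    dirDeriv (b k) (dirDeriv (b j) v) (y₀ + t • e₁)
  let M' : ℝ → Matrix (Fin (m + 2)) (Fin (m + 2)) ℝ := fun t => of fun k j =>
    dirDeriv e₁ (dirDeriv (b k) (dirDeriv (b j) v)) (y₀ + t • e₁)
  let M'' : Matrix (Fin (m + 2)) (Fin (m + 2)) ℝ := of fun k j =>
    dirDeriv e₁ (dirDeriv e₁ (dirDeriv (b k) (dirDeriv (b j) v))) y₀
  have hM : ∀ t, y₀ + t • e₁ ∈ V → M t = Bᵀ * hessian v (y₀ + t • e₁) * B := by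
    intro t ht
    ext k j
    exact dirDeriv_dirDeriv_columns hV hv2' ht B k j
  have horth : ∀ k j, dirDeriv (b k) (dirDeriv (b j) v) y₀ = (1 : Matrix (Fin (m + 2)) (Fin (m + 2)) ℝ) k j := by
    intro k j
    rw [← hB]
    exact dirDeriv_dirDeriv_columns hV hv2' hy B k j
  obtain ⟨htr, htr2⟩ := trace_of_det_eq_rpow (M := M) (M' := M') (M'' := M'')
    (p := fun t => -dirDeriv eₙ v (y₀ + t • e₁))
    (p' := fun t => -dirDeriv e₁ (dirDeriv eₙ v) (y₀ + t • e₁))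
    (p'' := -dirDeriv e₁ (dirDeriv e₁ (dirDeriv eₙ v)) y₀) (β := β) (c := B.det ^ 2 * c)
    (by ext k j; simpa [M] using horth k j)
    (by
      filter_upwards [hline] with t ht k j
      exact hasDerivAt_line (differentiableAt_of_contDiffOn hV (hv2 _ _) two_ne_zero ht))
    (fun k j => hder0 (hv1 _ _ _))
    (by
      filter_upwards [hline] with t ht
      exact (hasDerivAt_line (differentiableAt_of_contDiffOn hV (hv3 _) three_ne_zero ht)).neg)
    (hder0 ((hv2 _ _).of_le (by norm_num))).neg
    (by simpa using hn)
    (by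
      filter_upwards [hline, hdet] with t ht hd
      rw [hM t ht, det_mul, det_mul, det_transpose, hd]; ring)
  simp only [zero_smul, add_zero, neg_div_neg_eq, hq] at htr htr2
  set T := M' 0 with hTdef
  have hT : ∀ k j, T k j = dirDeriv e₁ (dirDeriv (b k) (dirDeriv (b j) v)) y₀ := by
    intro k j; simp [T, M']
  have hTsymm : T.IsSymm := by
    ext k j
    rw [transpose_apply, hT, hT]
    exact dirDeriv_congr hV (fun y hy => dirDeriv_comm hV hv2' hy _ _) hy
  -- derivatives of the factors of the auxiliary function
  have hcoord : ContDiff ℝ 4 fun y : EuclideanSpace ℝ (Fin (m + 2)) => y (Fin.last (m + 1)) := by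
    fun_prop
  let W : EuclideanSpace ℝ (Fin (m + 2)) → ℝ := fun y => -(y (Fin.last (m + 1)) + σ * v y) - ε
  have hWC : ContDiffOn ℝ 2 W V := by
    have h1 : ContDiffOn ℝ 2 (fun y : EuclideanSpace ℝ (Fin (m + 2)) => y (Fin.last (m + 1))) V :=
      (hcoord.of_le (by norm_num)).contDiffOn
    exact ((h1.add (contDiffOn_const.mul hv2')).neg).sub contDiffOn_const
  have hW1 : ∀ a, ∀ y ∈ V, dirDeriv a W y = -a (Fin.last (m + 1)) - σ * dirDeriv a v y := by
    intro a y hyV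
    have h1 := hasDerivAt_line (x := y) (a := a) (t := 0) (g := v)
      (by simpa using differentiableAt_of_contDiffOn hV hv2' two_ne_zero hyV)
    have h2 : HasDerivAt (fun s : ℝ => (y + s • a) (Fin.last (m + 1))) (a (Fin.last (m + 1))) 0 := by
      have := ((hasDerivAt_id (0 : ℝ)).mul_const (a (Fin.last (m + 1)))).const_add
        (y (Fin.last (m + 1)))
      simpa using this
    have h3 := ((h2.add (h1.const_mul σ)).neg.sub_const ε).deriv
    simp only [zero_smul, add_zero] at h3
    have h4 : dirDeriv a W y = -(a (Fin.last (m + 1)) + σ * dirDeriv a v y) := h3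
    rw [h4]; ring
  have hW2 : ∀ a, dirDeriv a (dirDeriv a W) y₀ = -σ * dirDeriv a (dirDeriv a v) y₀ := by
    intro a
    rw [dirDeriv_congr hV (hW1 a) hy]
    have h1 := hasDerivAt_line (x := y₀) (a := a) (t := 0) (g := dirDeriv a v)
      (by simpa using differentiableAt_of_contDiffOn hV (hv3 a) three_ne_zero hy)
    have h3 := ((h1.const_mul σ).const_sub (-a (Fin.last (m + 1)))).deriv
    simp only [zero_smul, add_zero] at h3
    rw [neg_mul]
    exact h3
  have hmax' := fun a => isLocalMax_mul_mul_exp (f := W) hV hy hWC (hv2 e₁ e₁)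
    ((hv3 e₁).of_le (by norm_num)) (by simpa only [W, hweq] using hw) (by rw [hl]; exact hlpos)
    hmax a
  have hWy : W y₀ = w := hweq
  simp only [hWy, hl, hp] at hmax'
  have hb0D : ∀ g : EuclideanSpace ℝ (Fin (m + 2)) → ℝ, dirDeriv (b 0) g =
      fun y => μ⁻¹ * dirDeriv e₁ g y := fun g => by
    funext y; rw [hb0, dirDeriv_smul]
  have hD1 : ∀ k, dirDeriv (b k) (dirDeriv e₁ v) y₀ = μ * (1 : Matrix (Fin (m + 2)) (Fin (m + 2)) ℝ) 0 k := by
    intro k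
    have := horth 0 k
    simp only [hb0D] at this
    rw [← this, dirDeriv_comm hV hv2' hy]
    field_simp
  have hD2 : ∀ k, dirDeriv (b k) (dirDeriv e₁ (dirDeriv e₁ v)) y₀ = μ * T 0 k := by
    intro k
    rw [hT, hb0D, dirDeriv_const_mul _
      (differentiableAt_of_contDiffOn hV (hv2 _ _) two_ne_zero hy),
      dirDeriv_dirDeriv_dirDeriv_comm hV (hv.of_le (by norm_num)) hy]
    field_simp
  have hD3 : ∀ k, dirDeriv (b k) (dirDeriv (b k) (dirDeriv e₁ v)) y₀ = T k k := by
    intro k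
    rw [hT, dirDeriv_dirDeriv_dirDeriv_comm hV (hv.of_le (by norm_num)) hy]
  have hD4 : ∀ k, dirDeriv (b k) (dirDeriv (b k) (dirDeriv e₁ (dirDeriv e₁ v))) y₀ = M'' k k := by
    intro k
    rw [dirDeriv_congr hV (fun y hy => dirDeriv_dirDeriv_dirDeriv_comm hV
      (hv.of_le (by norm_num)) hy (b k) e₁) hy, dirDeriv_dirDeriv_dirDeriv_comm hV (hv3 _) hy]
    rfl
  set X := dirDeriv e₁ (dirDeriv e₁ (dirDeriv eₙ v)) y₀ with hX
  set Y := dirDeriv e₁ (dirDeriv eₙ v) y₀ with hY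
  have hfirst_n : (-1 - σ * q) / w + X / l + γ * p * Y = 0 := by
    have := (hmax' eₙ).1
    rw [hW1 eₙ y₀ hy, dirDeriv_dirDeriv_dirDeriv_comm hV (hv.of_le (by norm_num)) hy,
      dirDeriv_comm hV hv2' hy eₙ e₁, hq] at this
    simpa [heₙ] using this
  let ω : Fin (m + 2) → ℝ := fun k => dirDeriv (b k) W y₀ / w
  have hfirst : ∀ k, ω k + T 0 k / μ + γ * p * (μ * (1 : Matrix (Fin (m + 2)) (Fin (m + 2)) ℝ) 0 k) = 0 := by
    intro k
    have := (hmax' (b k)).1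
    rw [hD2, hD1, ← hμl] at this
    rw [← this]
    simp only [ω]
    field_simp
  have hsecond : ∀ k, -σ / w - ω k ^ 2 + (M'' k k / l - T 0 k ^ 2 / l)
      + γ * (l * (1 : Matrix (Fin (m + 2)) (Fin (m + 2)) ℝ) 0 k + p * T k k) ≤ 0 := by
    intro k
    have := (hmax' (b k)).2
    rw [hD1, hD2, hD3, hD4, hW2, horth, one_apply_eq, mul_one] at this
    have e1 : (μ * T 0 k / l) ^ 2 = T 0 k ^ 2 / l := by rw [← hμl]; field_simp
    have e2 : (μ * (1 : Matrix (Fin (m + 2)) (Fin (m + 2)) ℝ) 0 k) ^ 2 =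
        l * (1 : Matrix (Fin (m + 2)) (Fin (m + 2)) ℝ) 0 k := by
      rw [mul_pow, hμl]
      simp only [one_apply]
      split_ifs <;> simp
    rw [e1, e2] at this
    exact this
  have hsum : -σ * (m + 2) / w - (∑ k, ω k ^ 2) + (M''.trace / l - (∑ k, T 0 k ^ 2) / l)
      + γ * (l + p * T.trace) ≤ 0 := by
    have h1 := Finset.sum_nonpos fun k (_ : k ∈ Finset.univ) => hsecond k
    have h2 : ∑ k : Fin (m + 2), (1 : Matrix (Fin (m + 2)) (Fin (m + 2)) ℝ) 0 k = 1 := by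
      simp [one_apply]
    simp only [Finset.sum_add_distrib, Finset.sum_sub_distrib, ← Finset.mul_sum,
      ← Finset.sum_div, h2, mul_one, Finset.sum_const, Finset.card_univ, Fintype.card_fin,
      nsmul_eq_mul] at h1
    push_cast at h1
    have e : -σ * (m + 2) / w = (m + 2) * -σ / w := by ring
    rw [e]
    exact h1
  have hω0 : ω 0 = -(σ * p) / (μ * w) := by
    have h1 : (b 0) (Fin.last (m + 1)) = 0 := by
      rw [hb0]; simp [he₁]
    simp only [ω]
    rw [hW1 _ _ hy, h1]
    simp only [hb0D, hp]
    field_simp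
    ring
  have hT00 : T 0 0 = -(-(σ * p / w) + γ * p * l) := by
    have := hfirst 0
    rw [hω0, one_apply_eq, mul_one] at this
    have h2 : T 0 0 / μ = -(-(σ * p) / (μ * w)) - γ * p * μ := by linarith
    rw [div_eq_iff hμ.ne'] at h2
    rw [h2, ← hμl]
    field_simp
    ring
  have hTI := trace_inequality hTsymm (ω := ω) (A := Y / q) (B := -(σ * p / w) + γ * p * l)
    hμ hα hβ htr hT00 (by
      intro i
      have := hfirst i.succ
      rw [one_apply_ne (Fin.succ_ne_zero i).symm] at this
      have h2 : -T 0 i.succ / μ = -(T 0 i.succ / μ) := by ring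
      rw [h2]; linarith)
  rw [hμl] at hTI
  have hω0sq : ω 0 ^ 2 = (σ * p) ^ 2 / (w ^ 2 * l) := by
    rw [hω0, ← hμl]; field_simp
  rw [hω0sq] at hTI
  have hq0 : q ≠ 0 := by rw [← hq]; exact hn.ne
  rw [htr, htr2] at hsum
  have hz : β / q * ((-1 - σ * q) / w + X / l + γ * p * Y) = 0 := by rw [hfirst_n, mul_zero]
  have hid : -σ * (m + 2) / w - (∑ k, ω k ^ 2)
      + (((∑ i, ∑ j, T i j * T j i) + β * (X / q - (Y / q) ^ 2)) / l - (∑ k, T 0 k ^ 2) / l)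
      + γ * (l + p * (β * (Y / q)))
      = (σ * (β - (m + 2)) + β / q) / w + γ * l + (-(∑ k, ω k ^ 2) +
      ((∑ i, ∑ j, T i j * T j i) - (∑ i, T 0 i ^ 2) - β * (Y / q) ^ 2) / l)
      + β / q * ((-1 - σ * q) / w + X / l + γ * p * Y) := by
    field_simp
    ring
  rw [hid, hz, add_zero] at hsum
  linarith

section SetLast

variable {k : ℕ} (x : EuclideanSpace ℝ (Fin (k + 1))) (s t : ℝ)

@[simp] theorem setLast_last : setLast x s (Fin.last k) = s := by simp [setLast]

theorem setLast_of_ne {i : Fin (k + 1)} (hi : i ≠ Fin.last k) : setLast x s i = x i := by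
  simp [setLast, hi]

@[simp] theorem setLast_setLast : setLast (setLast x s) t = setLast x t := by
  simp [setLast]

@[simp] theorem setLast_self : setLast x (x (Fin.last k)) = x := by
  ext i; simp [setLast]

theorem setLast_eq_add :
    setLast x s = x + (s - x (Fin.last k)) • EuclideanSpace.single (Fin.last k) (1 : ℝ) := by
  ext i
  by_cases hi : i = Fin.last k
  · subst hi; simp
  · simp [setLast_of_ne _ _ hi, hi]

end SetLast

section LevelGraph

variable {k : ℕ} {Ω : Set (EuclideanSpace ℝ (Fin (k + 1)))}
  {u : EuclideanSpace ℝ (Fin (k + 1)) → ℝ}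

theorem levelGraph_eq (hinc : IncreasingInLast Ω u) {y : EuclideanSpace ℝ (Fin (k + 1))} {t : ℝ}
    (ht : setLast y t ∈ Ω) (hu : u (setLast y t) = y (Fin.last k)) : levelGraph Ω u y = -t := by
  have : {t : ℝ | setLast y t ∈ Ω ∧ u (setLast y t) = y (Fin.last k)} = {t} := by
    ext s
    refine ⟨fun ⟨hs, hus⟩ => ?_, fun h => by rw [h]; exact ⟨ht, hu⟩⟩
    rcases lt_trichotomy s t with h | h | h
    · have := hinc _ hs t (by simpa using h) (by simpa using ht)
      simp [hu, hus] at this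
    · exact h
    · have := hinc _ ht s (by simpa using h) (by simpa using hs)
      simp [hu, hus] at this
  rw [levelGraph, this, csInf_singleton]

theorem levelGraph_setLast (hinc : IncreasingInLast Ω u) {x : EuclideanSpace ℝ (Fin (k + 1))}
    (hx : x ∈ Ω) : levelGraph Ω u (setLast x (u x)) = -x (Fin.last k) :=
  levelGraph_eq hinc (by simpa using hx) (by simp)

/-- A convex differentiable function which is strictly increasing in the last variable has positive
derivative in this variable. -/
theorem partialDeriv_last_pos (hΩ : IsOpen Ω) (hu : DifferentiableOn ℝ u Ω) (hc : ConvexOn ℝ Ω u)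
    (hinc : IncreasingInLast Ω u) {x : EuclideanSpace ℝ (Fin (k + 1))} (hx : x ∈ Ω) :
    0 < partialDeriv (Fin.last k) u x := by
  set e : EuclideanSpace ℝ (Fin (k + 1)) := EuclideanSpace.single (Fin.last k) 1 with he
  let L : ℝ →ᵃ[ℝ] EuclideanSpace ℝ (Fin (k + 1)) := AffineMap.lineMap x (x + e)
  have hL : ∀ t, L t = x + t • e := fun t => by simp [L, AffineMap.lineMap_apply, add_comm]
  have hcL := hc.comp_affineMap L
  have hgL : u ∘ L = fun s => u (x + s • e) := funext fun s => by simp [hL]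
  have hd : HasDerivAt (u ∘ L) (partialDeriv (Fin.last k) u x) 0 := by
    rw [hgL]
    have := hasDerivAt_line (x := x) (a := e) (t := 0) (g := u)
      (by simpa using (hu.differentiableAt (hΩ.mem_nhds hx)))
    rw [partialDeriv_eq_dirDeriv]
    simpa using this
  obtain ⟨s, hs, hs0⟩ : ∃ s : ℝ, x + s • e ∈ Ω ∧ s < 0 := by
    have h1 := (eventually_line_mem hΩ hx e).filter_mono (nhdsWithin_le_nhds (s := Set.Iio 0))
    exact (h1.and self_mem_nhdsWithin).exists
  have hlt : (u ∘ L) s < (u ∘ L) 0 := by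
    simp only [hgL, zero_smul, add_zero]
    have hset : setLast (x + s • e) (x (Fin.last k)) = x := by
      rw [setLast_eq_add]; ext i; by_cases hi : i = Fin.last k
      · subst hi; simp [he]
      · simp [he]
    have := hinc (x + s • e) hs (x (Fin.last k)) (by simp [he, hs0]) (by rwa [hset])
    rwa [hset] at this
  have hsl := hcL.slope_le_of_hasDerivAt (x := s) (y := 0) (by simpa [hL] using hs)
    (by simpa [hL] using hx) hs0 hd
  refine lt_of_lt_of_le ?_ hsl
  rw [slope_def_field]
  exact div_pos (by linarith) (by linarith)

/-- The map `x ↦ (x', u(x))` is locally invertible, and the graph function of the level sets is as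
regular as `u`. -/
theorem contDiffAt_levelGraph (hΩ : IsOpen Ω) {r : WithTop ℕ∞} (hr : r ≠ 0)
    (hu : ContDiffOn ℝ r u Ω) (hinc : IncreasingInLast Ω u)
    {x : EuclideanSpace ℝ (Fin (k + 1))} (hx : x ∈ Ω) (hpos : 0 < partialDeriv (Fin.last k) u x) :
    ContDiffAt ℝ r (levelGraph Ω u) (setLast x (u x)) ∧
      (fun x => setLast x (u x)) '' Ω ∈ 𝓝 (setLast x (u x)) := by
  set e : EuclideanSpace ℝ (Fin (k + 1)) := EuclideanSpace.single (Fin.last k) 1 with he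
  let Φ : EuclideanSpace ℝ (Fin (k + 1)) → EuclideanSpace ℝ (Fin (k + 1)) :=
    fun x => setLast x (u x)
  have hΦeq : Φ = fun x => x + (u x - x (Fin.last k)) • e := funext fun x => setLast_eq_add x (u x)
  have hux : ContDiffAt ℝ r u x := hu.contDiffAt (hΩ.mem_nhds hx)
  have hΦ : ContDiffAt ℝ r Φ x := by
    rw [hΦeq]
    have : ContDiffAt ℝ r (fun x : EuclideanSpace ℝ (Fin (k + 1)) => x (Fin.last k)) x := by
      fun_prop
    exact contDiffAt_id.add ((hux.sub this).smul contDiffAt_const)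
  have hΦ' : HasFDerivAt Φ (fderiv ℝ Φ x) x := (hΦ.differentiableAt hr).hasFDerivAt
  have hΦa : ∀ a, fderiv ℝ Φ x a = a + (fderiv ℝ u x a - a (Fin.last k)) • e := by
    intro a
    have h1 : HasFDerivAt (fun x : EuclideanSpace ℝ (Fin (k + 1)) => x (Fin.last k))
        (EuclideanSpace.proj (Fin.last k) : EuclideanSpace ℝ (Fin (k + 1)) →L[ℝ] ℝ) x :=
      (EuclideanSpace.proj (Fin.last k) : EuclideanSpace ℝ (Fin (k + 1)) →L[ℝ] ℝ).hasFDerivAt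
    have h2 := (hasFDerivAt_id (𝕜 := ℝ) x).add
      (((hux.differentiableAt hr).hasFDerivAt.sub h1).smul_const e)
    rw [hΦeq, HasFDerivAt.fderiv (f := fun x => x + (u x - x (Fin.last k)) • e) h2]
    simp
  have hinj : Function.Injective (fderiv ℝ Φ x : EuclideanSpace ℝ (Fin (k + 1)) →ₗ[ℝ]
      EuclideanSpace ℝ (Fin (k + 1))) := by
    rw [← LinearMap.ker_eq_bot, LinearMap.ker_eq_bot']
    intro a ha
    have ha' : a + (fderiv ℝ u x a - a (Fin.last k)) • e = 0 := by rw [← hΦa]; exact ha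
    have h1 : a = a (Fin.last k) • e := by
      ext i
      by_cases hi : i = Fin.last k
      · subst hi; simp [he]
      · have := congrArg (fun z : EuclideanSpace ℝ (Fin (k + 1)) => z i) ha'
        simpa [he, hi] using this
    have h2 : fderiv ℝ u x a = 0 := by
      have := congrArg (fun z : EuclideanSpace ℝ (Fin (k + 1)) => z (Fin.last k)) ha'
      simpa [he] using this
    have h3 : fderiv ℝ u x e = partialDeriv (Fin.last k) u x :=
      (dirDeriv_eq_fderiv (hux.differentiableAt hr)).symm
    rw [h1, map_smul, h3, smul_eq_mul] at h2
    rw [h1, (mul_eq_zero.1 h2).resolve_right hpos.ne', zero_smul]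
  let φ : EuclideanSpace ℝ (Fin (k + 1)) ≃L[ℝ] EuclideanSpace ℝ (Fin (k + 1)) :=
    (LinearEquiv.ofInjectiveEndo _ hinj).toContinuousLinearEquiv
  have hφ : (φ : EuclideanSpace ℝ (Fin (k + 1)) →L[ℝ] EuclideanSpace ℝ (Fin (k + 1))) =
      fderiv ℝ Φ x := by
    ext1 a; rfl
  rw [← hφ] at hΦ'
  have hstrict := hΦ.hasStrictFDerivAt' hΦ' hr
  let g := hΦ.localInverse hΦ' hr
  have hg : ContDiffAt ℝ r g (Φ x) := hΦ.to_localInverse hΦ' hr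
  have hgx : g (Φ x) = x := hΦ.localInverse_apply_image hΦ' hr
  have hright : ∀ᶠ y in 𝓝 (Φ x), Φ (g y) = y := hstrict.eventually_right_inverse
  have hmem : ∀ᶠ y in 𝓝 (Φ x), g y ∈ Ω :=
    hg.continuousAt.eventually (by rw [hgx]; exact hΩ.mem_nhds hx)
  constructor
  · have heq : levelGraph Ω u =ᶠ[𝓝 (Φ x)] fun y => -(g y) (Fin.last k) := by
      filter_upwards [hright, hmem] with y h1 h2
      rw [← levelGraph_setLast hinc h2]
      exact congrArg _ h1.symm
    refine ContDiffAt.congr_of_eventuallyEq ?_ heq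
    have : ContDiff ℝ r (fun x : EuclideanSpace ℝ (Fin (k + 1)) => x (Fin.last k)) := by fun_prop
    exact (this.contDiffAt.comp _ hg).neg
  · filter_upwards [hright, hmem] with y h1 h2 using ⟨g y, h2, h1⟩

end LevelGraph

section Transform

variable {k : ℕ}

theorem dirDeriv_comp {E F : Type*} [NormedAddCommGroup E] [NormedSpace ℝ E]
    [NormedAddCommGroup F] [NormedSpace ℝ F] {g : F → ℝ} {Ψ : E → F} {L : E →L[ℝ] F} {y : E}
    (hg : DifferentiableAt ℝ g (Ψ y)) (hΨ : HasFDerivAt Ψ L y) (a : E) :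
    dirDeriv a (fun z => g (Ψ z)) y = dirDeriv (L a) g (Ψ y) := by
  have h := hg.hasFDerivAt.comp y hΨ
  have h' : dirDeriv a (fun z => g (Ψ z)) y = fderiv ℝ (fun z => g (Ψ z)) y a :=
    dirDeriv_eq_fderiv h.differentiableAt
  rw [h', dirDeriv_eq_fderiv hg, HasFDerivAt.fderiv (f := fun z => g (Ψ z)) h]
  rfl

/-- The matrix of the derivative of `y ↦ (y', -v(y))`. -/
noncomputable def graphMatrix (v : EuclideanSpace ℝ (Fin (k + 1)) → ℝ)
    (y : EuclideanSpace ℝ (Fin (k + 1))) : Matrix (Fin (k + 1)) (Fin (k + 1)) ℝ :=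
  1 + replicateCol Unit (Pi.single (Fin.last k) (1 : ℝ)) * replicateRow Unit
    (fun j => -(partialDeriv j v y + (1 : Matrix (Fin (k + 1)) (Fin (k + 1)) ℝ) (Fin.last k) j))

theorem det_graphMatrix (v : EuclideanSpace ℝ (Fin (k + 1)) → ℝ)
    (y : EuclideanSpace ℝ (Fin (k + 1))) :
    (graphMatrix v y).det = -partialDeriv (Fin.last k) v y := by
  rw [graphMatrix, det_one_add_replicateCol_mul_replicateRow]
  simp

theorem graphMatrix_column (v : EuclideanSpace ℝ (Fin (k + 1)) → ℝ)
    (y : EuclideanSpace ℝ (Fin (k + 1))) (j : Fin (k + 1)) :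
    (WithLp.toLp 2 fun i => graphMatrix v y i j : EuclideanSpace ℝ (Fin (k + 1))) =
      EuclideanSpace.single j 1 - (partialDeriv j v y +
        (EuclideanSpace.single j (1 : ℝ) : EuclideanSpace ℝ (Fin (k + 1))) (Fin.last k)) •
          EuclideanSpace.single (Fin.last k) (1 : ℝ) := by
  ext i
  by_cases hi : i = Fin.last k
  · subst hi
    simp [graphMatrix, mul_apply, one_apply]
  · simp [graphMatrix, mul_apply, one_apply, hi]

variable {Ω V : Set (EuclideanSpace ℝ (Fin (k + 1)))} {u v : EuclideanSpace ℝ (Fin (k + 1)) → ℝ}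

/-- First and second derivatives of a function `u` and of the graph function `v` of its level
sets. -/
theorem hessian_graph (hΩ : IsOpen Ω) (hV : IsOpen V) (hu : ContDiffOn ℝ 2 u Ω)
    (hv : ContDiffOn ℝ 2 v V) (hmem : ∀ y ∈ V, setLast y (-v y) ∈ Ω)
    (huv : ∀ y ∈ V, u (setLast y (-v y)) = y (Fin.last k))
    {y : EuclideanSpace ℝ (Fin (k + 1))} (hy : y ∈ V) :
    partialDeriv (Fin.last k) v y * partialDeriv (Fin.last k) u (setLast y (-v y)) = -1 ∧
    partialDeriv (Fin.last k) u (setLast y (-v y)) • hessian v y =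
      (graphMatrix v y)ᵀ * hessian u (setLast y (-v y)) * graphMatrix v y := by
  set e : EuclideanSpace ℝ (Fin (k + 1)) := EuclideanSpace.single (Fin.last k) 1 with he
  simp only [partialDeriv_eq_dirDeriv, ← he]
  let Ψ : EuclideanSpace ℝ (Fin (k + 1)) → EuclideanSpace ℝ (Fin (k + 1)) :=
    fun y => setLast y (-v y)
  have hproj : ∀ y : EuclideanSpace ℝ (Fin (k + 1)),
      HasFDerivAt (fun x : EuclideanSpace ℝ (Fin (k + 1)) => x (Fin.last k))
        (EuclideanSpace.proj (Fin.last k) : EuclideanSpace ℝ (Fin (k + 1)) →L[ℝ] ℝ) y :=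
    fun y => (EuclideanSpace.proj (Fin.last k) :
      EuclideanSpace ℝ (Fin (k + 1)) →L[ℝ] ℝ).hasFDerivAt
  have hvd : ∀ y ∈ V, DifferentiableAt ℝ v y := fun y hy =>
    differentiableAt_of_contDiffOn hV hv two_ne_zero hy
  have hud : ∀ x ∈ Ω, DifferentiableAt ℝ u x := fun y hy =>
    differentiableAt_of_contDiffOn hΩ hu two_ne_zero hy
  have hu1 : ∀ a, ∀ x ∈ Ω, DifferentiableAt ℝ (dirDeriv a u) x := fun a x hx =>
    differentiableAt_of_contDiffOn hΩ (contDiffOn_dirDeriv hΩ hu (l := 1) (by norm_num) a)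
      one_ne_zero hx
  have hv1 : ∀ a, ∀ x ∈ V, DifferentiableAt ℝ (dirDeriv a v) x := fun a x hx =>
    differentiableAt_of_contDiffOn hV (contDiffOn_dirDeriv hV hv (l := 1) (by norm_num) a)
      one_ne_zero hx
  have hΨ : ∀ y ∈ V, ∃ L : EuclideanSpace ℝ (Fin (k + 1)) →L[ℝ] EuclideanSpace ℝ (Fin (k + 1)),
      HasFDerivAt Ψ L y ∧ ∀ a, L a = a - (dirDeriv a v y + a (Fin.last k)) • e := by
    intro y hy
    have hΨeq : Ψ = fun y => y + (-v y - y (Fin.last k)) • e :=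
      funext fun y => setLast_eq_add y (-v y)
    have h2 := (hasFDerivAt_id (𝕜 := ℝ) y).add
      (((hvd y hy).hasFDerivAt.neg.sub (hproj y)).smul_const e)
    refine ⟨_, by rw [hΨeq]; exact h2, fun a => ?_⟩
    simp only [_root_.add_apply, ContinuousLinearMap.id_apply,
      ContinuousLinearMap.smulRight_apply, _root_.sub_apply,
      _root_.neg_apply, PiLp.proj_apply, dirDeriv_eq_fderiv (hvd y hy)]
    rw [sub_eq_add_neg a, ← neg_smul]
    congr 2
    ring
  have hsub : ∀ {g : EuclideanSpace ℝ (Fin (k + 1)) → ℝ} {x : EuclideanSpace ℝ (Fin (k + 1))},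
      DifferentiableAt ℝ g x → ∀ (a : EuclideanSpace ℝ (Fin (k + 1))) (c : ℝ),
      dirDeriv (a - c • e) g x = dirDeriv a g x - c * dirDeriv e g x := by
    intro g x hg a c
    simp [dirDeriv_eq_fderiv hg]
  have hfirst : ∀ a, ∀ y ∈ V, dirDeriv a u (Ψ y) =
      a (Fin.last k) + (dirDeriv a v y + a (Fin.last k)) * dirDeriv e u (Ψ y) := by
    intro a y hy
    obtain ⟨L, hL, hLa⟩ := hΨ y hy
    have hx : Ψ y ∈ Ω := hmem y hy
    have h1 := dirDeriv_comp (Ψ := Ψ) (hud _ hx) hL a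
    have huv' : Set.EqOn (fun z => u (Ψ z)) (fun z => z (Fin.last k)) V := huv
    rw [hLa, hsub (hud _ hx), dirDeriv_congr hV huv' hy,
      dirDeriv_eq_fderiv (hproj y).differentiableAt, (hproj y).fderiv] at h1
    simp only [PiLp.proj_apply] at h1
    linarith
  constructor
  · have := hfirst e y hy
    have h1 : e (Fin.last k) = 1 := by simp [he]
    rw [h1] at this
    change dirDeriv e v y * dirDeriv e u (Ψ y) = -1
    linarith
  · ext i j
    rw [← dirDeriv_dirDeriv_columns hΩ hu (hmem y hy), graphMatrix_column, graphMatrix_column]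
    simp only [partialDeriv_eq_dirDeriv, ← he, Matrix.smul_apply, smul_eq_mul, hessian_apply]
    set a : EuclideanSpace ℝ (Fin (k + 1)) := EuclideanSpace.single j 1
    set b : EuclideanSpace ℝ (Fin (k + 1)) := EuclideanSpace.single i 1
    obtain ⟨L, hL, hLa⟩ := hΨ y hy
    rw [← hLa b]
    set c := dirDeriv a v y + a (Fin.last k) with hc
    have hx : Ψ y ∈ Ω := hmem y hy
    change dirDeriv e u (Ψ y) * _ = dirDeriv (L b) (dirDeriv (a - c • e) u) (Ψ y)
    have h1 : dirDeriv (L b) (dirDeriv (a - c • e) u) (Ψ y) =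
        dirDeriv (L b) (dirDeriv a u) (Ψ y) - c * dirDeriv (L b) (dirDeriv e u) (Ψ y) := by
      rw [dirDeriv_congr hΩ (fun x hx => hsub (hud x hx) a c) hx]
      have hd := (hu1 e _ hx).const_mul c
      rw [dirDeriv_eq_fderiv ((hu1 a _ hx).fun_sub hd), fderiv_fun_sub (hu1 a _ hx) hd,
        _root_.sub_apply, ← dirDeriv_eq_fderiv hd, ← dirDeriv_eq_fderiv (hu1 a _ hx),
        dirDeriv_const_mul c (hu1 e _ hx)]
    have h2 := dirDeriv_comp (hu1 a _ hx) hL b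
    have h3 := dirDeriv_comp (hu1 e _ hx) hL b
    rw [dirDeriv_congr hV (hfirst a) hy] at h2
    have d1 : DifferentiableAt ℝ (fun z => dirDeriv e u (Ψ z)) y :=
      ((hu1 e _ hx).hasFDerivAt.comp y hL).differentiableAt
    have d2 : DifferentiableAt ℝ (fun z => dirDeriv a v z + a (Fin.last k)) y :=
      (hv1 a y hy).add_const _
    have h4 : dirDeriv b (fun z => a (Fin.last k) +
        (dirDeriv a v z + a (Fin.last k)) * dirDeriv e u (Ψ z)) y =
        c * dirDeriv b (fun z => dirDeriv e u (Ψ z)) y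
          + dirDeriv e u (Ψ y) * dirDeriv b (dirDeriv a v) y := by
      rw [dirDeriv_eq_fderiv ((d2.fun_mul d1).const_add _), fderiv_const_add, fderiv_fun_mul d2 d1,
        fderiv_add_const, dirDeriv_eq_fderiv d1, dirDeriv_eq_fderiv (hv1 a y hy)]
      simp [hc]
    rw [h1, ← h2, ← h3, h4]
    ring

end Transform

theorem posSemidef_hessian {n : ℕ} {Ω : Set (EuclideanSpace ℝ (Fin n))}
    {u : EuclideanSpace ℝ (Fin n) → ℝ} (hΩ : IsOpen Ω) (hu : ContDiffOn ℝ 2 u Ω)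
    (hc : ConvexOn ℝ Ω u) {x : EuclideanSpace ℝ (Fin n)} (hx : x ∈ Ω) :
    (hessian u x).PosSemidef := by
  refine PosSemidef.of_dotProduct_mulVec_nonneg ?_ fun a => ?_
  · ext i j
    exact dirDeriv_comm hΩ hu hx _ _
  · have h := dirDeriv_dirDeriv_columns hΩ hu hx (replicateCol Unit a) () ()
    have hnonneg := dirDeriv_dirDeriv_nonneg hΩ hu hc hx (WithLp.toLp 2 a)
    have e : ((replicateCol Unit a)ᵀ * hessian u x * replicateCol Unit a) () () =
        star a ⬝ᵥ (hessian u x *ᵥ a) := by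
      rw [Matrix.mul_assoc]
      simp [mul_apply, dotProduct, mulVec]
    rw [← e, ← h]
    exact hnonneg

/-- A strictly positive definite Hessian prevents interior maxima of `u - σ xₙ`. -/
theorem le_of_eq_on_frontier {m : ℕ} {Ω : Set (EuclideanSpace ℝ (Fin (m + 2)))}
    {u : EuclideanSpace ℝ (Fin (m + 2)) → ℝ} {σ : ℝ} (hΩ : IsOpen Ω)
    (hb : Bornology.IsBounded Ω) (hu : ContDiffOn ℝ 2 u Ω) (huc : ContinuousOn u (closure Ω))
    (hpd : ∀ x ∈ Ω, (hessian u x).PosDef)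
    (hbd : ∀ x ∈ frontier Ω, u x = σ * x (Fin.last (m + 1)))
    {x : EuclideanSpace ℝ (Fin (m + 2))} (hx : x ∈ Ω) : u x ≤ σ * x (Fin.last (m + 1)) := by
  let h : EuclideanSpace ℝ (Fin (m + 2)) → ℝ := fun x => u x - σ * x (Fin.last (m + 1))
  have hlin : ContDiff ℝ 2 fun x : EuclideanSpace ℝ (Fin (m + 2)) => σ * x (Fin.last (m + 1)) := by
    fun_prop
  have hcomp : IsCompact (closure Ω) := hb.isCompact_closure
  obtain ⟨z, hz, hmax⟩ := hcomp.exists_isMaxOn ⟨x, subset_closure hx⟩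
    (f := h) (huc.sub hlin.continuous.continuousOn)
  have hxz : h x ≤ h z := hmax (subset_closure hx)
  have hz0 : h z ≤ 0 := by
    by_cases hzΩ : z ∈ Ω
    · exfalso
      have hloc : IsLocalMax h z := hmax.isLocalMax (mem_of_superset (hΩ.mem_nhds hzΩ) subset_closure)
      have h2 := (dirDeriv_of_isLocalMax hΩ (hu.sub hlin.contDiffOn) hzΩ hloc
        (EuclideanSpace.single 0 1)).2
      have h3 : ∀ y ∈ Ω, dirDeriv (EuclideanSpace.single 0 1) h y =
          dirDeriv (EuclideanSpace.single 0 1) u y := by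
        intro y hy
        have hd := differentiableAt_of_contDiffOn hΩ hu two_ne_zero hy
        have h1 := hasDerivAt_line (x := y) (a := EuclideanSpace.single 0 1) (t := 0) (g := u)
          (by simpa using hd)
        have h4 := (h1.sub_const (σ * y (Fin.last (m + 1)))).deriv
        simp only [zero_smul, add_zero] at h4
        rw [← h4]
        change deriv (fun t : ℝ => h (y + t • EuclideanSpace.single 0 1)) 0 = _
        congr 1
        funext t
        simp [h]
      have h5 : 0 < hessian u z 0 0 := (hpd z hzΩ).diag_pos
      rw [hessian_apply, ← dirDeriv_congr hΩ h3 hzΩ] at h5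
      exact absurd h2 (not_le.2 h5)
    · have : z ∈ frontier Ω := ⟨hz, by rwa [hΩ.interior_eq]⟩
      simp [h, hbd z this]
  have := hxz.trans hz0
  simp only [h] at this
  linarith

/-- The bound on the maximum extracted from the inequality at a maximum point. -/
theorem bound_of_inequality {b β σ γ w l p q M₁ M₂ : ℝ} (hw : 0 < w) (hl : 0 < l)
    (hγ : γ = 3 / (4 * (M₂ ^ 2 + 1))) (hp : |p| ≤ M₂) (hβ : 0 ≤ β) (hb : 0 ≤ b)
    (hq : -(β * |M₁|) ≤ β / q)
    (h : (b + β / q) / w + γ * l - (σ * p) ^ 2 / (w ^ 2 * l)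
      - (-(σ * p / w) + γ * p * l) ^ 2 / (3 * l) ≤ 0) :
    w * l ≤ 1 + 2 / γ * (β * |M₁| + 2 * σ ^ 2 * M₂ ^ 2) := by
  have hγ0 : 0 < γ := by rw [hγ]; positivity
  have hp2 : p ^ 2 ≤ M₂ ^ 2 := sq_le_sq' (by linarith [abs_le.1 hp]) (abs_le.1 hp).2
  have hγp : γ * p ^ 2 ≤ 3 / 4 := by
    calc γ * p ^ 2 ≤ γ * (M₂ ^ 2 + 1) := by gcongr; linarith
      _ = 3 / 4 := by rw [hγ]; field_simp
  set W := w * l with hW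
  have hWpos : 0 < W := mul_pos hw hl
  have h1 : (b + β / q) * W + γ * W ^ 2 - (σ * p) ^ 2 - (-(σ * p) + γ * p * W) ^ 2 / 3 ≤ 0 := by
    have e : (b + β / q) * W + γ * W ^ 2 - (σ * p) ^ 2 - (-(σ * p) + γ * p * W) ^ 2 / 3 =
        (w ^ 2 * l) * ((b + β / q) / w + γ * l - (σ * p) ^ 2 / (w ^ 2 * l)
      - (-(σ * p / w) + γ * p * l) ^ 2 / (3 * l)) := by
      generalize β / q = r
      rw [hW]; field_simp
    rw [e]
    exact mul_nonpos_of_nonneg_of_nonpos (by positivity) h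
  have h2 : (-(σ * p) + γ * p * W) ^ 2 ≤ 2 * (σ * p) ^ 2 + 2 * (γ * p * W) ^ 2 := by
    nlinarith [sq_nonneg (σ * p + γ * p * W)]
  have h3 : (γ * p * W) ^ 2 ≤ 3 / 4 * (γ * W ^ 2) := by
    calc (γ * p * W) ^ 2 = (γ * p ^ 2) * (γ * W ^ 2) := by ring
      _ ≤ 3 / 4 * (γ * W ^ 2) := by gcongr
  have h4 : (σ * p) ^ 2 ≤ σ ^ 2 * M₂ ^ 2 := by rw [mul_pow]; gcongr
  have h5 : -(β * |M₁|) * W ≤ (b + β / q) * W := by gcongr; linarith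
  have h6 : γ / 2 * W ^ 2 ≤ β * |M₁| * W + 2 * σ ^ 2 * M₂ ^ 2 := by
    have : 0 ≤ σ ^ 2 * M₂ ^ 2 := by positivity
    linarith
  have hR : 0 ≤ 2 * σ ^ 2 * M₂ ^ 2 := by positivity
  have hS : 0 ≤ β * |M₁| := by positivity
  by_cases hW1 : W ≤ 1
  · have : 0 ≤ 2 / γ * (β * |M₁| + 2 * σ ^ 2 * M₂ ^ 2) := by positivity
    linarith
  · push Not at hW1
    have h7 : γ / 2 * W ≤ β * |M₁| + 2 * σ ^ 2 * M₂ ^ 2 := by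
      refine le_of_mul_le_mul_right ?_ hWpos
      nlinarith
    have h8 : W = 2 / γ * (γ / 2 * W) := by field_simp
    have h9 : 2 / γ * (γ / 2 * W) ≤ 2 / γ * (β * |M₁| + 2 * σ ^ 2 * M₂ ^ 2) := by gcongr
    linarith

/-- The graph function `v` of the level sets of a convex solution `u` of
`uₙ ^ α det D²u = f(x₂, …, xₙ₋₁, u)` solves `det D²v = f (-vₙ) ^ (n + 2 + α)` and has positive
definite Hessian. -/
theorem levelGraph_equation {m : ℕ} {Ω V : Set (EuclideanSpace ℝ (Fin (m + 2)))}
    {u v : EuclideanSpace ℝ (Fin (m + 2)) → ℝ} {f : (Fin m → ℝ) → ℝ → ℝ} {α : ℝ}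
    (hΩ : IsOpen Ω) (hV : IsOpen V) (hu : ContDiffOn ℝ 2 u Ω) (hv : ContDiffOn ℝ 2 v V)
    (hmem : ∀ y ∈ V, setLast y (-v y) ∈ Ω)
    (huv : ∀ y ∈ V, u (setLast y (-v y)) = y (Fin.last (m + 1)))
    (hpos : ∀ x ∈ Ω, 0 < partialDeriv (Fin.last (m + 1)) u x)
    (hpd : ∀ x ∈ Ω, (hessian u x).PosDef)
    (heq : ∀ x ∈ Ω, partialDeriv (Fin.last (m + 1)) u x ^ α * (hessian u x).det =
      f (middle x) (u x))
    {y : EuclideanSpace ℝ (Fin (m + 2))} (hy : y ∈ V) :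
    (hessian v y).PosDef ∧ (hessian v y).det = f (middle y) (y (Fin.last (m + 1))) *
      (-partialDeriv (Fin.last (m + 1)) v y) ^ (m + 4 + α) := by
  obtain ⟨h1, h2⟩ := hessian_graph hΩ hV hu hv hmem huv hy
  have hx := hmem y hy
  have hmid : middle (setLast y (-v y)) = middle y := by
    funext i
    exact setLast_of_ne _ _ (Fin.castSucc_lt_last _).ne
  have heq' := heq _ hx
  rw [hmid, huv y hy] at heq'
  have hpd' := hpd _ hx
  have hp' := hpos _ hx
  set x := setLast y (-v y)
  set r := partialDeriv (Fin.last (m + 1)) u x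
  have hq : -partialDeriv (Fin.last (m + 1)) v y = r⁻¹ := by
    field_simp
    linarith
  have hdetT : (graphMatrix v y).det = r⁻¹ := by rw [det_graphMatrix, hq]
  have h3 : hessian v y = r⁻¹ • ((graphMatrix v y)ᵀ * hessian u x * graphMatrix v y) := by
    rw [← h2, smul_smul, inv_mul_cancel₀ hp'.ne', one_smul]
  constructor
  · rw [h3]
    refine PosDef.smul ?_ (inv_pos.2 hp')
    have := hpd'.conjTranspose_mul_mul_same (B := graphMatrix v y) (by
      rw [mulVec_injective_iff_isUnit, isUnit_iff_isUnit_det, hdetT]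
      exact (inv_pos.2 hp').ne'.isUnit)
    rwa [conjTranspose_eq_transpose_of_trivial] at this
  · rw [h3, det_smul, det_mul, det_mul, det_transpose, hdetT, hq, ← heq', Fintype.card_fin]
    have e1 : r⁻¹ ^ ((m : ℝ) + 4 + α) = r⁻¹ ^ (m + 4) * (r ^ α)⁻¹ := by
      rw [Real.rpow_add (inv_pos.2 hp'), Real.inv_rpow hp'.le α]
      congr 1
      exact_mod_cast Real.rpow_natCast r⁻¹ (m + 4)
    have e2 : r ^ α * (r ^ α)⁻¹ = 1 := mul_inv_cancel₀ (Real.rpow_pos_of_pos hp' α).ne'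
    have e3 : r⁻¹ ^ (m + 4) = r⁻¹ ^ (m + 2) * (r⁻¹ * r⁻¹) := by ring
    rw [e1, e3]
    linear_combination (-(r⁻¹ ^ (m + 2) * (r⁻¹ * r⁻¹) * (hessian u x).det)) * e2

end LevelSetEstimate

open LevelSetEstimate

theorem theorem5p2 (m : ℕ) (α σ : ℝ) (hα : 0 ≤ α) (hσ : 0 < σ) (M₁ M₂ : ℝ) :
    ∃ C : ℝ, ∀ (Ω : Set (EuclideanSpace ℝ (Fin (m + 2))))
      (u : EuclideanSpace ℝ (Fin (m + 2)) → ℝ) (f : (Fin m → ℝ) → ℝ → ℝ),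
      IsOpen Ω → Bornology.IsBounded Ω →
      ContDiffOn ℝ 4 u Ω → ContinuousOn u (closure Ω) → ConvexOn ℝ Ω u →
      LevelSetEstimate.IncreasingInLast Ω u →
      (∀ x ∈ frontier Ω, u x = σ * x (Fin.last (m + 1))) →
      (∀ x ∈ Ω, 0 < f (LevelSetEstimate.middle x) (u x)) →
      (∀ x ∈ Ω, LevelSetEstimate.partialDeriv (Fin.last (m + 1)) u x ^ α
          * (LevelSetEstimate.hessian u x).det = f (LevelSetEstimate.middle x) (u x)) →
      (∀ x ∈ Ω, LevelSetEstimate.partialDeriv (Fin.last (m + 1)) u x ≤ M₁) →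
      (∀ x ∈ Ω, |LevelSetEstimate.partialDeriv 0 (LevelSetEstimate.levelGraph Ω u)
          (LevelSetEstimate.setLast x (u x))| ≤ M₂) →
      ∀ x ∈ Ω,
        ContDiffAt ℝ 4 (LevelSetEstimate.levelGraph Ω u) (LevelSetEstimate.setLast x (u x)) ∧
        LevelSetEstimate.partialDeriv 0
            (LevelSetEstimate.partialDeriv 0 (LevelSetEstimate.levelGraph Ω u))
            (LevelSetEstimate.setLast x (u x)) * |u x - σ * x (Fin.last (m + 1))| ≤ C := by
  obtain ⟨γ, hγ⟩ : ∃ γ : ℝ, γ = 3 / (4 * (M₂ ^ 2 + 1)) := ⟨_, rfl⟩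
  obtain ⟨β, hβ⟩ : ∃ β : ℝ, β = m + 4 + α := ⟨_, rfl⟩
  have hγ0 : 0 < γ := by rw [hγ]; positivity
  have hβ0 : 0 ≤ β := by rw [hβ]; positivity
  refine ⟨(1 + 2 / γ * (β * |M₁| + 2 * σ ^ 2 * M₂ ^ 2)) * Real.exp (γ / 2 * M₂ ^ 2), ?_⟩
  intro Ω u f hΩ hb hu huc hc hinc hbd hf heq hM₁ hM₂
  have hu2 : ContDiffOn ℝ 2 u Ω := hu.of_le (by norm_num)
  have hpos : ∀ x ∈ Ω, 0 < partialDeriv (Fin.last (m + 1)) u x := fun x hx =>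
    partialDeriv_last_pos hΩ (hu2.differentiableOn two_ne_zero) hc hinc hx
  have hpd : ∀ x ∈ Ω, (hessian u x).PosDef := by
    intro x hx
    rw [(posSemidef_hessian hΩ hu2 hc hx).posDef_iff_det_ne_zero]
    intro h0
    have := hf x hx
    rw [← heq x hx, h0, mul_zero] at this
    exact this.false
  set v := levelGraph Ω u with hvdef
  let V := (fun x => setLast x (u x)) '' Ω
  have hreg := fun x (hx : x ∈ Ω) =>
    contDiffAt_levelGraph hΩ four_ne_zero hu hinc hx (hpos x hx)
  have hV : IsOpen V := by
    rw [isOpen_iff_mem_nhds]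
    rintro _ ⟨x, hx, rfl⟩
    exact (hreg x hx).2
  have hv : ContDiffOn ℝ 4 v V := by
    rintro _ ⟨x, hx, rfl⟩
    exact (hreg x hx).1.contDiffWithinAt
  have hvx : ∀ x ∈ Ω, v (setLast x (u x)) = -x (Fin.last (m + 1)) := fun x hx =>
    levelGraph_setLast hinc hx
  have hinv : ∀ x ∈ Ω, setLast (setLast x (u x)) (-v (setLast x (u x))) = x := fun x hx => by
    rw [hvx x hx]; simp
  have hmem : ∀ y ∈ V, setLast y (-v y) ∈ Ω := by
    rintro _ ⟨x, hx, rfl⟩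
    simpa only [hinv x hx] using hx
  have huv : ∀ y ∈ V, u (setLast y (-v y)) = y (Fin.last (m + 1)) := by
    rintro _ ⟨x, hx, rfl⟩
    simp only [hinv x hx, setLast_last]
  have hv2 : ContDiffOn ℝ 2 v V := hv.of_le (by norm_num)
  have heqv := fun y (hy : y ∈ V) => levelGraph_equation hΩ hV hu2 hv2 hmem huv hpos hpd heq hy
  have hv11 : ∀ y ∈ V, 0 < partialDeriv 0 (partialDeriv 0 v) y := fun y hy =>
    (heqv y hy).1.diag_pos
  have hCpos : 0 ≤ (1 + 2 / γ * (β * |M₁| + 2 * σ ^ 2 * M₂ ^ 2)) * Real.exp (γ / 2 * M₂ ^ 2) := by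
    positivity
  intro x hx
  refine ⟨(hreg x hx).1, ?_⟩
  have hle : u x ≤ σ * x (Fin.last (m + 1)) := le_of_eq_on_frontier hΩ hb hu2 huc hpd hbd hx
  rw [abs_of_nonpos (by linarith), neg_sub]
  set C := (1 + 2 / γ * (β * |M₁| + 2 * σ ^ 2 * M₂ ^ 2)) * Real.exp (γ / 2 * M₂ ^ 2) with hCdef
  have hxV : setLast x (u x) ∈ V := ⟨x, hx, rfl⟩
  have key : ∀ ε : ℝ, 0 < ε → partialDeriv 0 (partialDeriv 0 v) (setLast x (u x)) *
      (σ * x (Fin.last (m + 1)) - u x - ε) ≤ C := by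
    intro ε hε
    by_cases hxε : σ * x (Fin.last (m + 1)) - u x ≤ ε
    · exact (mul_nonpos_of_nonneg_of_nonpos (hv11 _ hxV).le (by linarith)).trans hCpos
    push Not at hxε
    have hlin : Continuous fun x : EuclideanSpace ℝ (Fin (m + 2)) => σ * x (Fin.last (m + 1)) := by
      fun_prop
    have hwc : ContinuousOn (fun x => σ * x (Fin.last (m + 1)) - u x) (closure Ω) :=
      hlin.continuousOn.sub huc
    let K := closure Ω ∩ (fun x => σ * x (Fin.last (m + 1)) - u x) ⁻¹' Set.Ici ε
    have hK : IsCompact K := hb.isCompact_closure.of_isClosed_subset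
      (hwc.preimage_isClosed_of_isClosed isClosed_closure isClosed_Ici) Set.inter_subset_left
    have hKΩ : K ⊆ Ω := by
      rintro z ⟨hz, hz'⟩
      by_contra hzΩ
      have : z ∈ frontier Ω := ⟨hz, by rwa [hΩ.interior_eq]⟩
      have h1 : ε ≤ σ * z (Fin.last (m + 1)) - u z := hz'
      rw [hbd z this] at h1
      linarith
    let P : EuclideanSpace ℝ (Fin (m + 2)) → ℝ := fun y =>
      (-(y (Fin.last (m + 1)) + σ * v y) - ε) * partialDeriv 0 (partialDeriv 0 v) y *
        Real.exp (γ / 2 * partialDeriv 0 v y ^ 2)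
    have hPw : ∀ z ∈ Ω, -((setLast z (u z)) (Fin.last (m + 1)) + σ * v (setLast z (u z))) =
        σ * z (Fin.last (m + 1)) - u z := by
      intro z hz
      rw [hvx z hz, setLast_last]; ring
    have hwcV : ContinuousOn (fun y : EuclideanSpace ℝ (Fin (m + 2)) =>
        -(y (Fin.last (m + 1)) + σ * v y)) V := by
      have : Continuous fun x : EuclideanSpace ℝ (Fin (m + 2)) => x (Fin.last (m + 1)) := by
        fun_prop
      exact (this.continuousOn.add (continuousOn_const.mul hv.continuousOn)).neg
    have hPc : ContinuousOn P V := by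
      have h1 : ContDiffOn ℝ 3 (partialDeriv 0 v) V := contDiffOn_dirDeriv hV hv (by norm_num) _
      have h2 : ContDiffOn ℝ 2 (partialDeriv 0 (partialDeriv 0 v)) V :=
        contDiffOn_dirDeriv hV h1 (by norm_num) _
      exact ((hwcV.sub continuousOn_const).mul h2.continuousOn).mul
        (continuousOn_const.mul (h1.continuousOn.pow 2)).rexp
    have hΦc : ContinuousOn (fun x => setLast x (u x)) Ω := by
      have : (fun x => setLast x (u x)) = fun x : EuclideanSpace ℝ (Fin (m + 2)) =>
          x + (u x - x (Fin.last (m + 1))) • EuclideanSpace.single (Fin.last (m + 1)) (1 : ℝ) :=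
        funext fun x => setLast_eq_add x (u x)
      rw [this]
      have h1 : Continuous fun x : EuclideanSpace ℝ (Fin (m + 2)) => x (Fin.last (m + 1)) := by
        fun_prop
      exact continuousOn_id.add ((hu.continuousOn.sub h1.continuousOn).smul continuousOn_const)
    have hxK : x ∈ K := ⟨subset_closure hx, hxε.le⟩
    obtain ⟨x₀, hx₀, hmax⟩ := hK.exists_isMaxOn ⟨x, hxK⟩
      ((hPc.comp hΦc fun z hz => ⟨z, hz, rfl⟩).mono hKΩ)
    have hx₀Ω := hKΩ hx₀
    obtain ⟨y₀, hy₀⟩ : ∃ y₀, y₀ = setLast x₀ (u x₀) := ⟨_, rfl⟩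
    have hy₀V : y₀ ∈ V := ⟨x₀, hx₀Ω, hy₀.symm⟩
    have hPx : P (setLast x (u x)) ≤ P y₀ := by rw [hy₀]; exact hmax hxK
    have hPxval : partialDeriv 0 (partialDeriv 0 v) (setLast x (u x)) *
        (σ * x (Fin.last (m + 1)) - u x - ε) ≤ P (setLast x (u x)) := by
      simp only [P]
      rw [hPw x hx, mul_comm]
      refine le_mul_of_one_le_right ?_ (Real.one_le_exp (by positivity))
      exact mul_nonneg (by linarith) (hv11 _ hxV).le
    have hPxpos : 0 < P (setLast x (u x)) :=
      (mul_pos (hv11 _ hxV) (by linarith)).trans_le hPxval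
    have hw₀ : 0 < -(y₀ (Fin.last (m + 1)) + σ * v y₀) - ε := by
      have h1 := hPxpos.trans_le hPx
      by_contra! h2
      exact absurd h1 (not_lt.2 (mul_nonpos_of_nonpos_of_nonneg
        (mul_nonpos_of_nonpos_of_nonneg h2 (hv11 _ hy₀V).le) (Real.exp_pos _).le))
    have hlocmax : IsLocalMax P y₀ := by
      have h1 : ∀ᶠ y in 𝓝 y₀, ε < -(y (Fin.last (m + 1)) + σ * v y) :=
        (hwcV.continuousAt (hV.mem_nhds hy₀V)).eventually (lt_mem_nhds (by linarith))
      filter_upwards [h1, hV.mem_nhds hy₀V] with y h2 h3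
      obtain ⟨z, hz, rfl⟩ := h3
      have h4 : z ∈ K := by
        refine ⟨subset_closure hz, ?_⟩
        rw [hPw z hz] at h2
        exact h2.le
      rw [hy₀]
      exact hmax h4
    have hqr := (hessian_graph hΩ hV hu2 hv2 hmem huv hy₀V).1
    have hx₀' : setLast y₀ (-v y₀) = x₀ := by rw [hy₀]; exact hinv x₀ hx₀Ω
    rw [hx₀'] at hqr
    have hr := hpos x₀ hx₀Ω
    have hq0 : partialDeriv (Fin.last (m + 1)) v y₀ < 0 := by
      by_contra! h
      have := mul_nonneg h hr.le
      linarith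
    have hineq := inequality_at_isLocalMax (c := f (middle y₀) (y₀ (Fin.last (m + 1)))) hV hv hy₀V
      hα hβ (heqv y₀ hy₀V).1 hq0 (by
        filter_upwards [eventually_line_mem hV hy₀V (EuclideanSpace.single 0 1)] with t ht
        have h1 : middle (y₀ + t • EuclideanSpace.single 0 1) = middle y₀ := by
          funext i
          simp [middle]
        have h2 : (y₀ + t • EuclideanSpace.single 0 1 : EuclideanSpace ℝ (Fin (m + 2)))
            (Fin.last (m + 1)) = y₀ (Fin.last (m + 1)) := by
          simp
        rw [(heqv _ ht).2, h1, h2, hβ]) rfl hw₀ rfl rfl rfl hlocmax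
    have hp₀ : |partialDeriv 0 v y₀| ≤ M₂ := by rw [hy₀]; exact hM₂ x₀ hx₀Ω
    have hbound := bound_of_inequality (M₁ := M₁) hw₀ (hv11 _ hy₀V) hγ hp₀ hβ0
      (mul_nonneg hσ.le (by rw [hβ]; linarith)) (by
        have h1 : β / partialDeriv (Fin.last (m + 1)) v y₀ =
            -(β * partialDeriv (Fin.last (m + 1)) u x₀) := by
          rw [div_eq_iff hq0.ne]
          linear_combination β * hqr
        rw [h1]
        have h2 : partialDeriv (Fin.last (m + 1)) u x₀ ≤ |M₁| :=
          (hM₁ x₀ hx₀Ω).trans (le_abs_self _)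
        have := mul_le_mul_of_nonneg_left h2 hβ0
        linarith) hineq
    refine hPxval.trans (hPx.trans ?_)
    have hp2 : partialDeriv 0 v y₀ ^ 2 ≤ M₂ ^ 2 :=
      sq_le_sq' (by linarith [abs_le.1 hp₀]) (abs_le.1 hp₀).2
    have hexp : Real.exp (γ / 2 * partialDeriv 0 v y₀ ^ 2) ≤ Real.exp (γ / 2 * M₂ ^ 2) :=
      Real.exp_le_exp.2 (mul_le_mul_of_nonneg_left hp2 (by positivity))
    exact mul_le_mul hbound hexp (Real.exp_pos _).le (by positivity)
  have hlim : Tendsto (fun ε : ℝ => partialDeriv 0 (partialDeriv 0 v) (setLast x (u x)) *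
      (σ * x (Fin.last (m + 1)) - u x - ε)) (𝓝[>] 0)
      (𝓝 (partialDeriv 0 (partialDeriv 0 v) (setLast x (u x)) *
        (σ * x (Fin.last (m + 1)) - u x - 0))) := by
    refine (Continuous.tendsto ?_ 0).mono_left nhdsWithin_le_nhds
    fun_prop
  rw [sub_zero] at hlim
  exact le_of_tendsto hlim (eventually_mem_nhdsWithin.mono fun ε hε => key ε hε)
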